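/- Let $p\ge 0$ and $n\ge p+1$ be integers and let $\Xi=\{\xi_1\le\dots\le\xi_{n+p+1}\}\subset\mathbb R$ be a $(p+1)$-basic knot vector: $\xi_{p+1}<\xi_{p+2}$, $\xi_n<\xi_{n+1}$, and $\xi_i<\xi_{i+p+1}$ for $1\le i\le n$. Put $a=\xi_{p+1}$, $b=\xi_{n+1}$. Let $B_1,\dots,B_n$ be the B-splines of degree $p$ on $[a,b]$ associated with $\Xi$ (right-continuous on $[a,b)$, left-continuous at $b$), let $\mathbb S=\operatorname{span}\{B_1,\dots,B_n\}$, and for $s=\sum_{i=1}^n c_iB_i\in\mathbb S$ put $$\|s\|_\Xi=\Big(\sum_{i=1}^n c_i^2\,\omega_i^2\Big)^{1/2},\qquad \omega_i=\Big(\frac{\xi_{i+p+1}-\xi_i}{p+1}\Big)^{1/2}.$$ Let $\zeta\in(a,b)$ be an interior breakpoint (a value of a knot), let $i_0$ be the index with $\xi_{i_0}=\zeta<\xi_{i_0+1}$, and let $\ell+1$ be the multiplicity of $\zeta$ in $\Xi$ (so $0\le\ell\le p$). Let $\hat{\mathbb S}\subset\mathbb S$ be the spline space of degree $p$ on $[a,b]$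 associated with the knot vector $\Xi\setminus\{\xi_{i_0}\}$, and define the knot-removal error $$\mathbb E(s)=\min_{g\in\hat{\mathbb S}}\|g-s\|_\Xi,\qquad s\in\mathbb S.$$ Put $$\alpha_j=\frac{\xi_{i_0}-\xi_{i_0-p-2+j}}{\xi_{i_0-1+j}-\xi_{i_0-p-2+j}},\quad e_j=\omega_{i_0-p-2+j}\quad(1\le j\le p+2-\ell),\qquad \mu_j=\frac{1-\alpha_{j+1}}{\alpha_j}\quad(1\le j\le p+1-\ell),$$ $$r_{p+2-\ell}=\gamma_{\rm loc}\,e_{p+2-\ell},\qquad \gamma_{\rm loc}=\Big(1+e_{p+2-\ell}^2\sum_{j=1}^{p+1-\ell}\frac1{e_j^2}\prod_{i=j}^{p+1-\ell}\mu_i^2\Big)^{-1/2},$$ $$C_{\rm loc}=r_{p+2-\ell}\,\frac{\ell!}{p!}\prod_{k=i_0+1}^{i_0+p-\ell}(\xi_k-\xi_{i_0}).$$ Then $C_{\rm loc}>0$; for the fixed $p$ and $\ell$ the constant $C_{\rm loc}$ depends only on the local knots $\Xi_{\rm loc}=\{\xi_{i_0-p-1},\dots,\xi_{i_0+p+1-\ell}\}$;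 and for every $s\in\mathbb S$ the one-sided limits of $D^{p-\ell}s$ at $\zeta$ exist, the minimum $\mathbb E(s)$ is attained, and $$\mathbb E(s)=C_{\rm loc}\,\big|J_\zeta(D^{p-\ell}s)\big|,\qquad J_\zeta(f)=\lim_{x\to\zeta^+}f(x)-\lim_{x\to\zeta^-}f(x).$$ -/

import Mathlib

open Filter Topology

noncomputable section

/-- `ξ 1 ≤ … ≤ ξ (n+p+1)` is a `(p+1)`-basic knot vector for degree `p` and dimension `n`
(only the values of `ξ` at the indices `1, …, n+p+1` are ever used).  The interval is
`[a, b] = [ξ (p+1), ξ (n+1)]`; the breakpoints are `a`, `b` and the knots strictly between them;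
every one of the latter occurs at most `p+1` times. -/
structure IsBasicKnotVector (p n : ℕ) (ξ : ℕ → ℝ) : Prop where
  le_dim : p + 1 ≤ n
  mono : MonotoneOn ξ (Set.Icc 1 (n + p + 1))
  left_lt : ξ (p + 1) < ξ (p + 2)
  lt_right : ξ n < ξ (n + 1)
  lt_add : ∀ i, 1 ≤ i → i ≤ n → ξ i < ξ (i + p + 1)

/-- The multiplicity of the value `ζ` in the knot vector `ξ 1, …, ξ (n+p+1)`. -/
def knotMultiplicity (p n : ℕ) (ξ : ℕ → ℝ) (ζ : ℝ) : ℕ :=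
  {i : ℕ | 1 ≤ i ∧ i ≤ n + p + 1 ∧ ξ i = ζ}.ncard

/-- The Cox–de Boor recursion.  The functions are right-continuous to the left of `b` and
left-continuous at `b`, so that the partition of unity also holds at the right endpoint `b`.
The convention `x / 0 = 0` is the usual one in this recursion. -/
def coxDeBoor (ξ : ℕ → ℝ) (b : ℝ) : ℕ → ℕ → ℝ → ℝ
  | 0, i, x =>
      if (x < b ∧ ξ i ≤ x ∧ x < ξ (i + 1)) ∨ (b ≤ x ∧ ξ i < x ∧ x ≤ ξ (i + 1)) then 1 else 0
  | k + 1, i, x =>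
      (x - ξ i) / (ξ (i + k + 1) - ξ i) * coxDeBoor ξ b k i x
        + (ξ (i + k + 2) - x) / (ξ (i + k + 2) - ξ (i + 1)) * coxDeBoor ξ b k (i + 1) x

/-- The `i`-th B-spline (`1 ≤ i ≤ n`) of degree `p`, a function on `[a, b]`, extended by zero. -/
def bspline (p n : ℕ) (ξ : ℕ → ℝ) (i : ℕ) : ℝ → ℝ :=
  (Set.Icc (ξ (p + 1)) (ξ (n + 1))).indicator (coxDeBoor ξ (ξ (n + 1)) p i)

/-- The spline space: the span of the B-splines `B_1, …, B_n`. -/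
def splineSpace (p n : ℕ) (ξ : ℕ → ℝ) : Submodule ℝ (ℝ → ℝ) :=
  Submodule.span ℝ (bspline p n ξ '' Set.Icc 1 n)

/-- `c` is a vector of control points of `f`: `f = ∑ c_i B_i`
(the entry `c i` with `i : Fin n` belongs to the B-spline with the index `i + 1`). -/
def IsControlPoints (p n : ℕ) (ξ : ℕ → ℝ) (f : ℝ → ℝ) (c : Fin n → ℝ) : Prop :=
  f = ∑ i : Fin n, c i • bspline p n ξ (i + 1)

/-- The vector of control points of a spline `f`. -/
def controlPoints (p n : ℕ) (ξ : ℕ → ℝ) (f : ℝ → ℝ) : Fin n → ℝ :=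
  Classical.epsilon (IsControlPoints p n ξ f)

/-- The weight `ω_i = ((ξ_{i+p+1} - ξ_i) / (p+1))^{1/2}`. -/
def knotWeight (p : ℕ) (ξ : ℕ → ℝ) (i : ℕ) : ℝ :=
  √((ξ (i + p + 1) - ξ i) / (p + 1))

/-- The `Ξ`-norm of a spline. -/
def xiNorm (p n : ℕ) (ξ : ℕ → ℝ) (f : ℝ → ℝ) : ℝ :=
  √(∑ i : Fin n, (controlPoints p n ξ f i) ^ 2 * ((ξ (i + 1 + p + 1) - ξ (i + 1)) / (p + 1)))

/-- The knot vector with the `i₀`-th knot removed. -/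
def removeKnot (ξ : ℕ → ℝ) (i₀ : ℕ) (i : ℕ) : ℝ :=
  if i < i₀ then ξ i else ξ (i + 1)

/-- `E` is the knot removal error `min_{g ∈ Ŝ} ‖g - s‖_Ξ`, where `Ŝ` is the spline space of the
knot vector without `ξ i₀`; the minimum is attained. -/
def IsKnotRemovalError (p n : ℕ) (ξ : ℕ → ℝ) (i₀ : ℕ) (s : ℝ → ℝ) (E : ℝ) : Prop :=
  IsLeast {r : ℝ | ∃ g ∈ splineSpace p (n - 1) (removeKnot ξ i₀), r = xiNorm p n ξ (g - s)} E

/-- `J` is the jump of `f` at `x`: the right limit minus the left limit (both of which exist). -/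
def HasJump (f : ℝ → ℝ) (x J : ℝ) : Prop :=
  ∃ R L : ℝ, Tendsto f (𝓝[>] x) (𝓝 R) ∧ Tendsto f (𝓝[<] x) (𝓝 L) ∧ J = R - L

/-- `α_j = (ξ_{i₀} - ξ_{i₀-p-2+j}) / (ξ_{i₀-1+j} - ξ_{i₀-p-2+j})`, for `1 ≤ j ≤ p+2-ℓ`. -/
def insertionCoeff (p : ℕ) (ξ : ℕ → ℝ) (i₀ j : ℕ) : ℝ :=
  (ξ i₀ - ξ (i₀ + j - (p + 2))) / (ξ (i₀ + j - 1) - ξ (i₀ + j - (p + 2)))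

/-- `μ_j = (1 - α_{j+1}) / α_j`, for `1 ≤ j ≤ p+1-ℓ`. -/
def muCoeff (p : ℕ) (ξ : ℕ → ℝ) (i₀ j : ℕ) : ℝ :=
  (1 - insertionCoeff p ξ i₀ (j + 1)) / insertionCoeff p ξ i₀ j

/-- `e_j = ω_{i₀-p-2+j}`, for `1 ≤ j ≤ p+2-ℓ`. -/
def localWeight (p : ℕ) (ξ : ℕ → ℝ) (i₀ j : ℕ) : ℝ :=
  knotWeight p ξ (i₀ + j - (p + 2))

/-- `γ_loc = (1 + e_{p+2-ℓ}² ∑_{j=1}^{p+1-ℓ} e_j⁻² ∏_{i=j}^{p+1-ℓ} μ_i²)^{-1/2}`. -/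
def gammaLoc (p ℓ : ℕ) (ξ : ℕ → ℝ) (i₀ : ℕ) : ℝ :=
  (√(1 + localWeight p ξ i₀ (p + 2 - ℓ) ^ 2 *
    ∑ j ∈ Finset.Icc 1 (p + 1 - ℓ),
      1 / localWeight p ξ i₀ j ^ 2 * ∏ i ∈ Finset.Icc j (p + 1 - ℓ), muCoeff p ξ i₀ i ^ 2))⁻¹

/-- `r_{p+2-ℓ} = γ_loc e_{p+2-ℓ}`. -/
def rLast (p ℓ : ℕ) (ξ : ℕ → ℝ) (i₀ : ℕ) : ℝ :=
  gammaLoc p ℓ ξ i₀ * localWeight p ξ i₀ (p + 2 - ℓ)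

/-- `C_loc = r_{p+2-ℓ} (ℓ! / p!) ∏_{k=i₀+1}^{i₀+p-ℓ} (ξ_k - ξ_{i₀})`. -/
def Cloc (p ℓ : ℕ) (ξ : ℕ → ℝ) (i₀ : ℕ) : ℝ :=
  rLast p ℓ ξ i₀ * ((ℓ.factorial : ℝ) / (p.factorial : ℝ)) *
    ∏ k ∈ Finset.Icc (i₀ + 1) (i₀ + (p - ℓ)), (ξ k - ξ i₀)

end

/-! The jump of `D^{p-ℓ} s` at `ζ` is a linear functional of the control points, `J = ∑ c_i κ_i`
with `κ_i` = `jumpCoeff`, and its kernel on the spline space is exactly the coarse space. The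
`Ξ`-norm is a weighted Euclidean norm with weights `w_i = ω_i²`, so the error is the distance to a
hyperplane, `|J| / (∑ κ_i² / w_i)^{1/2}`: Cauchy–Schwarz gives the lower bound and the vector
proportional to `κ_i / w_i` attains it (`isKnotRemovalError`).

It remains to compute the `κ_i`. Knot insertion (`coxDeBoor_removeKnot`) writes each coarse B-spline
touching `ζ` as a combination of two consecutive fine ones. The coarse B-spline has no jump, because
`ζ` has multiplicity only `ℓ` there; hence `κ_i = -μ_j κ_{i+1}`, with `i = i₀-p-2+j`. The last
nonzero one, `κ_{i₀-ℓ}`, belongs to the B-spline starting at `ζ` with full multiplicity and is found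
by repeated differentiation. All this yields `C_loc² ∑ κ_i² / w_i = 1` (`Cloc_sq_mul_sum`).

One-sided derivatives are computed on the polynomial pieces `coxDeBoorPiece`, where the derivative
formula is an algebraic identity. -/

/-- The inverse of a knot difference absorbs the normalized length of every larger knot interval. -/
theorem inv_sub_mul_inv_sub_mul {a b c d : ℝ} (hab : a ≤ b) (hbc : b ≤ c) (hcd : c ≤ d) :
    (c - b)⁻¹ * ((d - a)⁻¹ * (d - a)) = (c - b)⁻¹ := by
  rcases hbc.eq_or_lt with h | h
  · simp [h]
  · rw [inv_mul_cancel₀ (by linarith), mul_one]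

/-! ### Knot insertion for the Cox–de Boor functions -/

theorem coxDeBoor_congr {ξ ξ' : ℕ → ℝ} (b x : ℝ) (k : ℕ) : ∀ i : ℕ,
    (∀ j, i ≤ j → j ≤ i + k + 1 → ξ j = ξ' j) →
      coxDeBoor ξ b k i x = coxDeBoor ξ' b k i x := by
  induction k with
  | zero =>
    intro i h
    simp only [coxDeBoor]
    rw [h i (by omega) (by omega), h (i + 1) (by omega) (by omega)]
  | succ k ih =>
    intro i h
    simp only [coxDeBoor]
    rw [ih i (fun j h1 h2 => h j h1 (by omega)),
      ih (i + 1) (fun j h1 h2 => h j (by omega) (by omega)),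
      h i (by omega) (by omega), h (i + 1) (by omega) (by omega),
      h (i + k + 1) (by omega) (by omega), h (i + k + 2) (by omega) (by omega)]

theorem coxDeBoor_shift {ξ ξ' : ℕ → ℝ} (b x : ℝ) (k : ℕ) : ∀ i : ℕ,
    (∀ j, i ≤ j → ξ' j = ξ (j + 1)) →
      coxDeBoor ξ' b k i x = coxDeBoor ξ b k (i + 1) x := by
  induction k with
  | zero =>
    intro i h
    simp only [coxDeBoor]
    rw [h i (by omega), h (i + 1) (by omega)]
  | succ k ih =>
    intro i h
    simp only [coxDeBoor]
    rw [ih i h, ih (i + 1) (fun j h1 => h j (by omega)),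
      h i (by omega), h (i + 1) (by omega),
      h (i + k + 1) (by omega), h (i + k + 2) (by omega)]
    rw [show i + k + 1 + 1 = i + 1 + k + 1 by ring]

theorem removeKnot_of_lt {ξ : ℕ → ℝ} {i₀ i : ℕ} (h : i < i₀) : removeKnot ξ i₀ i = ξ i :=
  if_pos h

theorem removeKnot_of_le {ξ : ℕ → ℝ} {i₀ i : ℕ} (h : i₀ ≤ i) :
    removeKnot ξ i₀ i = ξ (i + 1) :=
  if_neg (by omega)

theorem monotone_removeKnot {ξ : ℕ → ℝ} (hξ : Monotone ξ) (i₀ : ℕ) :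
    Monotone (removeKnot ξ i₀) := by
  intro i j h
  unfold removeKnot
  split_ifs <;> exact hξ (by omega)

theorem coxDeBoor_removeKnot_of_lt {ξ : ℕ → ℝ} {i₀ k i : ℕ} (b x : ℝ) (h : i + k + 1 < i₀) :
    coxDeBoor (removeKnot ξ i₀) b k i x = coxDeBoor ξ b k i x :=
  coxDeBoor_congr b x k i fun _ _ _ => removeKnot_of_lt (by omega)

theorem coxDeBoor_removeKnot_of_le {ξ : ℕ → ℝ} {i₀ k i : ℕ} (b x : ℝ) (h : i₀ ≤ i) :
    coxDeBoor (removeKnot ξ i₀) b k i x = coxDeBoor ξ b k (i + 1) x :=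
  coxDeBoor_shift b x k i fun _ _ => removeKnot_of_le (by omega)

/-- Knot insertion for the B-splines whose support contains the inserted knot. -/
theorem coxDeBoor_removeKnot {ξ : ℕ → ℝ} (hξ : Monotone ξ) {i₀ : ℕ} (b x : ℝ) (k : ℕ) :
    ∀ i : ℕ, i < i₀ → i₀ ≤ i + k + 1 →
      coxDeBoor (removeKnot ξ i₀) b k i x =
        (ξ i₀ - ξ i) * ((ξ (i + k + 1) - ξ i)⁻¹ * coxDeBoor ξ b k i x)
        + (ξ (i + k + 2) - ξ i₀) *
          ((ξ (i + k + 2) - ξ (i + 1))⁻¹ * coxDeBoor ξ b k (i + 1) x) := by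
  induction k with
  | zero =>
    intro i h1 h2
    obtain rfl : i₀ = i + 1 := by omega
    -- Over an empty knot interval the degree 0 function vanishes, so the cancellation survives `0⁻¹
    -- = 0`.
    have e1 : ∀ j, (ξ (j + 1) - ξ j) * ((ξ (j + 1) - ξ j)⁻¹ * coxDeBoor ξ b 0 j x)
        = coxDeBoor ξ b 0 j x := by
      intro j
      rcases (hξ (Nat.le_succ j)).eq_or_lt with h | h
      · have : coxDeBoor ξ b 0 j x = 0 := by
          simp only [coxDeBoor, Nat.succ_eq_add_one] at h ⊢
          rw [if_neg]
          rw [h]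
          rintro (⟨_, h3, h4⟩ | ⟨_, h3, h4⟩) <;> linarith
        simp [this]
      · exact mul_inv_cancel_left₀ (by simpa using (sub_pos.2 h).ne') _
    have e2 := e1 i
    have e3 := e1 (i + 1)
    simp only [add_zero]
    rw [show i + 2 = i + 1 + 1 from rfl, e2, e3]
    have m1 := hξ (Nat.le_succ i)
    have m2 := hξ (Nat.le_succ (i + 1))
    simp only [Nat.succ_eq_add_one] at m1 m2
    simp only [coxDeBoor, removeKnot_of_lt h1, removeKnot_of_le (le_refl (i + 1))]
    split_ifs <;> first | (norm_num; done) | (exfalso; grind)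
  | succ k ih =>
    intro i h1 h2
    have h1' : removeKnot ξ i₀ i = ξ i := removeKnot_of_lt h1
    have h2' : removeKnot ξ i₀ (i + k + 2) = ξ (i + k + 3) := removeKnot_of_le (by omega)
    have kQ1 := inv_sub_mul_inv_sub_mul (hξ (show i ≤ i + 1 by omega))
      (hξ (show i + 1 ≤ i + k + 2 by omega)) (le_refl (ξ (i + k + 2)))
    have kQ2 := inv_sub_mul_inv_sub_mul (le_refl (ξ (i + 1)))
      (hξ (show i + 1 ≤ i + k + 2 by omega)) (hξ (show i + k + 2 ≤ i + k + 3 by omega))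
    have kP := inv_sub_mul_inv_sub_mul (le_refl (ξ i))
      (hξ (show i ≤ i + k + 1 by omega)) (hξ (show i + k + 1 ≤ i + k + 2 by omega))
    have kR := inv_sub_mul_inv_sub_mul (hξ (show i + 1 ≤ i + 2 by omega))
      (hξ (show i + 2 ≤ i + k + 3 by omega)) (le_refl (ξ (i + k + 3)))
    -- Either the removed knot meets this support and induction applies, or it is the next knot;
    -- then the coefficient of the second B-spline vanishes. `f2` is the mirror image.
    have f1 : (removeKnot ξ i₀ (i + k + 1) - ξ i)⁻¹ * coxDeBoor (removeKnot ξ i₀) b k i x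
        = (ξ (i + k + 2) - ξ i)⁻¹ *
          ((ξ i₀ - ξ i) * ((ξ (i + k + 1) - ξ i)⁻¹ * coxDeBoor ξ b k i x)
          + (ξ (i + k + 2) - ξ i₀) *
            ((ξ (i + k + 2) - ξ (i + 1))⁻¹ * coxDeBoor ξ b k (i + 1) x)) := by
      rcases Nat.lt_or_ge (i + k + 1) i₀ with h | h
      · obtain rfl : i₀ = i + k + 2 := by omega
        rw [removeKnot_of_lt h, coxDeBoor_removeKnot_of_lt b x h]
        linear_combination (-coxDeBoor ξ b k i x) * kP
      · rw [removeKnot_of_le h, ih i h1 h]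
    have f2 : (ξ (i + k + 3) - removeKnot ξ i₀ (i + 1))⁻¹ *
          coxDeBoor (removeKnot ξ i₀) b k (i + 1) x
        = (ξ (i + k + 3) - ξ (i + 1))⁻¹ *
          ((ξ i₀ - ξ (i + 1)) * ((ξ (i + k + 2) - ξ (i + 1))⁻¹ * coxDeBoor ξ b k (i + 1) x)
          + (ξ (i + k + 3) - ξ i₀) *
            ((ξ (i + k + 3) - ξ (i + 2))⁻¹ * coxDeBoor ξ b k (i + 2) x)) := by
      rcases Nat.lt_or_ge (i + 1) i₀ with h | h
      · rw [removeKnot_of_lt h, ih (i + 1) h (by omega)]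
        rw [show i + 1 + k + 1 = i + k + 2 by ring, show i + 1 + k + 2 = i + k + 3 by ring]
      · obtain rfl : i₀ = i + 1 := by omega
        rw [removeKnot_of_le h, coxDeBoor_removeKnot_of_le b x h]
        linear_combination (-coxDeBoor ξ b k (i + 2) x) * kR
    simp only [coxDeBoor]
    rw [h1', h2', show i + (k + 1) + 1 = i + k + 2 by ring,
      show i + (k + 1) + 2 = i + k + 3 by ring,
      show i + 1 + k + 1 = i + k + 2 by ring, show i + 1 + k + 2 = i + k + 3 by ring,
      show i + 1 + 1 = i + 2 by ring]
    simp only [div_eq_mul_inv]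
    -- Only the coefficient of the middle B-spline needs checking: its two quotients change by `x -
    -- ξ i₀` and by `-(x - ξ i₀)`.
    linear_combination (x - ξ i) * f1 + (ξ (i + k + 3) - x) * f2
      + coxDeBoor ξ b k (i + 1) x * (x - ξ i₀) * (kQ1 - kQ2)

/-! ### Polynomial pieces: derivatives, partition of unity, local independence -/

/-- The polynomial that agrees with the `i`-th B-spline of degree `k` between the knots `ξ m` and
`ξ (m + 1)`. -/
noncomputable def coxDeBoorPiece (ξ : ℕ → ℝ) (m : ℕ) : ℕ → ℕ → Polynomial ℝ
  | 0, i => if i = m then 1 else 0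
  | k + 1, i =>
      Polynomial.C (ξ (i + k + 1) - ξ i)⁻¹ * (Polynomial.X - Polynomial.C (ξ i))
          * coxDeBoorPiece ξ m k i
        + Polynomial.C (ξ (i + k + 2) - ξ (i + 1))⁻¹ *
          (Polynomial.C (ξ (i + k + 2)) - Polynomial.X) * coxDeBoorPiece ξ m k (i + 1)

theorem coxDeBoorPiece_succ (ξ : ℕ → ℝ) (m k i : ℕ) : coxDeBoorPiece ξ m (k + 1) i =
    Polynomial.C (ξ (i + k + 1) - ξ i)⁻¹ * (Polynomial.X - Polynomial.C (ξ i))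
        * coxDeBoorPiece ξ m k i
      + Polynomial.C (ξ (i + k + 2) - ξ (i + 1))⁻¹ *
        (Polynomial.C (ξ (i + k + 2)) - Polynomial.X) * coxDeBoorPiece ξ m k (i + 1) :=
  rfl

theorem coxDeBoor_eq_eval_piece {ξ : ℕ → ℝ} (hξ : Monotone ξ) {b x : ℝ} {m : ℕ}
    (h1 : ξ m < x) (h2 : x < ξ (m + 1)) (hb : x < b) (k : ℕ) : ∀ i : ℕ,
    coxDeBoor ξ b k i x = (coxDeBoorPiece ξ m k i).eval x := by
  induction k with
  | zero =>
    intro i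
    simp only [coxDeBoor, coxDeBoorPiece]
    by_cases h : i = m
    · subst h
      rw [if_pos (Or.inl ⟨hb, h1.le, h2⟩)]
      simp
    · rw [if_neg, if_neg h, Polynomial.eval_zero]
      rintro (⟨_, h3, h4⟩ | ⟨h3, _⟩)
      · rcases Nat.lt_or_gt_of_ne h with h5 | h5
        · have := hξ (show i + 1 ≤ m by omega)
          linarith
        · have := hξ (show m + 1 ≤ i by omega)
          linarith
      · linarith
  | succ k ih =>
    intro i
    simp only [coxDeBoor, coxDeBoorPiece, ih, Polynomial.eval_add, Polynomial.eval_mul,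
      Polynomial.eval_C, Polynomial.eval_sub, Polynomial.eval_X]
    ring

theorem coxDeBoorPiece_eq_zero (ξ : ℕ → ℝ) (m k : ℕ) : ∀ i : ℕ, (m < i ∨ i + k < m) →
    coxDeBoorPiece ξ m k i = 0 := by
  induction k with
  | zero =>
    intro i h
    rw [coxDeBoorPiece, if_neg (by omega)]
  | succ k ih =>
    intro i h
    rw [coxDeBoorPiece, ih i (by omega), ih (i + 1) (by omega)]
    simp

/-- The product rule and the formula one degree lower leave terms that the recursion reassembles.
For single pieces this is pure algebra, valid at coinciding knots too. -/
theorem derivative_coxDeBoorPiece {ξ : ℕ → ℝ} (hξ : Monotone ξ) (m k : ℕ) : ∀ i : ℕ,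
    (coxDeBoorPiece ξ m (k + 1) i).derivative =
      Polynomial.C (((k : ℝ) + 1) * (ξ (i + k + 1) - ξ i)⁻¹) * coxDeBoorPiece ξ m k i
      - Polynomial.C (((k : ℝ) + 1) * (ξ (i + k + 2) - ξ (i + 1))⁻¹) *
        coxDeBoorPiece ξ m k (i + 1) := by
  induction k with
  | zero =>
    intro i
    have h0 : ∀ j, (coxDeBoorPiece ξ m 0 j).derivative = 0 := by
      intro j
      rw [coxDeBoorPiece]
      split_ifs <;> simp
    rw [coxDeBoorPiece_succ]
    simp only [Polynomial.derivative_add, Polynomial.derivative_mul, h0, Polynomial.derivative_C,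
      Polynomial.derivative_sub, Polynomial.derivative_X]
    simp
    ring
  | succ k ih =>
    intro i
    have kQ1 := congrArg Polynomial.C (inv_sub_mul_inv_sub_mul (hξ (show i ≤ i + 1 by omega))
      (hξ (show i + 1 ≤ i + k + 2 by omega)) (le_refl (ξ (i + k + 2))))
    have kQ2 := congrArg Polynomial.C (inv_sub_mul_inv_sub_mul (le_refl (ξ (i + 1)))
      (hξ (show i + 1 ≤ i + k + 2 by omega)) (hξ (show i + k + 2 ≤ i + k + 3 by omega)))
    have e1 := ih i
    have e2 := ih (i + 1)
    have r1 := coxDeBoorPiece_succ ξ m k i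
    have r2 := coxDeBoorPiece_succ ξ m k (i + 1)
    rw [show i + 1 + k + 1 = i + k + 2 by ring, show i + 1 + k + 2 = i + k + 3 by ring,
      show i + 1 + 1 = i + 2 by ring] at e2 r2
    have r3 := coxDeBoorPiece_succ ξ m (k + 1) i
    rw [show i + (k + 1) + 1 = i + k + 2 by ring,
      show i + (k + 1) + 2 = i + k + 3 by ring] at r3 ⊢
    rw [show k + 1 + 1 = k + 2 by ring, r3]
    simp only [Polynomial.derivative_add, Polynomial.derivative_mul, e1, e2,
      Polynomial.derivative_C, Polynomial.derivative_sub, Polynomial.derivative_X]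
    simp only [map_mul, map_sub, map_add, map_natCast, map_one, Nat.cast_add, Nat.cast_one]
      at kQ1 kQ2 r1 r2 ⊢
    linear_combination (-((k : Polynomial ℝ) + 1) * Polynomial.C (ξ (i + k + 2) - ξ i)⁻¹) * r1
      + (((k : Polynomial ℝ) + 1) * Polynomial.C (ξ (i + k + 3) - ξ (i + 1))⁻¹) * r2
      + ((k : Polynomial ℝ) + 1) * coxDeBoorPiece ξ m k (i + 1) * (kQ2 - kQ1)

/-- Summation by parts: collects the two terms of a recursion at the same B-spline. The truncated `0
- 1` is harmless since `g 0 = 0`. -/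
theorem sum_range_mul_succ_eq {R : Type*} [CommRing R] (M : ℕ) (f g : ℕ → R) (h0 : g 0 = 0)
    (hM : g M = 0) :
    ∑ i ∈ Finset.range M, f i * g (i + 1) = ∑ i ∈ Finset.range M, f (i - 1) * g i := by
  have h1 := Finset.sum_range_succ (fun i => f (i - 1) * g i) M
  have h2 := Finset.sum_range_succ' (fun i => f (i - 1) * g i) M
  simp only [hM, h0, mul_zero, add_zero, Nat.add_sub_cancel] at h1 h2
  rw [← h2, h1]

theorem sum_coxDeBoorPiece {ξ : ℕ → ℝ} (hξ : Monotone ξ) {m M : ℕ} (hm : ξ m < ξ (m + 1))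
    (hM : m < M) (k : ℕ) : k < m + 1 →
    ∑ i ∈ Finset.range M, coxDeBoorPiece ξ m k i = 1 := by
  induction k with
  | zero =>
    intro _
    simp [coxDeBoorPiece, hM]
  | succ k ih =>
    intro hk
    rw [← ih (by omega)]
    simp only [coxDeBoorPiece, Finset.sum_add_distrib]
    rw [sum_range_mul_succ_eq M (fun i => Polynomial.C (ξ (i + k + 2) - ξ (i + 1))⁻¹ *
      (Polynomial.C (ξ (i + k + 2)) - Polynomial.X)) (fun i => coxDeBoorPiece ξ m k i)
      (coxDeBoorPiece_eq_zero ξ m k 0 (by omega)) (coxDeBoorPiece_eq_zero ξ m k M (by omega)),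
      ← Finset.sum_add_distrib]
    refine Finset.sum_congr rfl fun i _ => ?_
    by_cases h : m < i ∨ i + k < m
    · simp [coxDeBoorPiece_eq_zero ξ m k i h]
    · rcases i with _ | i
      · rw [coxDeBoorPiece_eq_zero ξ m k 0 (by omega)]
        simp
      · have h1 := hξ (show i + 1 ≤ m by omega)
        have h2 := hξ (show m + 1 ≤ i + 1 + k + 1 by omega)
        have h3 : (ξ (i + 1 + k + 1) - ξ (i + 1))⁻¹ * (ξ (i + 1 + k + 1) - ξ (i + 1)) = 1 :=
          inv_mul_cancel₀ (by linarith)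
        have h4 := congrArg Polynomial.C h3
        simp only [Nat.add_sub_cancel]
        rw [show i + k + 2 = i + 1 + k + 1 by ring]
        simp only [map_mul, map_sub, map_one] at h4
        linear_combination coxDeBoorPiece ξ m k (i + 1) * h4

/-- The B-splines that do not vanish between two knots are linearly independent there. -/
theorem eq_zero_of_sum_coxDeBoorPiece_eq_zero {ξ : ℕ → ℝ} (hξ : Monotone ξ) {m M : ℕ}
    (hm : ξ m < ξ (m + 1)) (hM : m < M) (k : ℕ) : k < m + 1 → ∀ c : ℕ → ℝ,
    ∑ i ∈ Finset.range M, Polynomial.C (c i) * coxDeBoorPiece ξ m k i = 0 →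
      ∀ i, i ≤ m → m ≤ i + k → c i = 0 := by
  induction k with
  | zero =>
    intro _ c h i h1 h2
    obtain rfl : i = m := by omega
    simpa [coxDeBoorPiece, hM] using h
  | succ k ih =>
    intro hk c h i h1 h2
    have hd := congrArg Polynomial.derivative h
    simp only [Polynomial.derivative_sum, Polynomial.derivative_C_mul,
      derivative_coxDeBoorPiece hξ, mul_sub, Finset.sum_sub_distrib, map_zero, ← mul_assoc] at hd
    rw [sum_range_mul_succ_eq M (fun i => Polynomial.C (c i) *
      Polynomial.C (((k : ℝ) + 1) * (ξ (i + k + 2) - ξ (i + 1))⁻¹))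
      (fun i => coxDeBoorPiece ξ m k i)
      (coxDeBoorPiece_eq_zero ξ m k 0 (by omega)) (coxDeBoorPiece_eq_zero ξ m k M (by omega)),
      ← Finset.sum_sub_distrib] at hd
    -- The differentiated relation has degree `k` and divided differences of `c` as coefficients, so
    -- induction makes `c` constant on the active range; partition of unity then makes that constant
    -- zero.
    have hstep : ∀ i, i ≤ m → m ≤ i + k → c i = c (i - 1) := by
      intro i h1 h2
      have hz := ih (by omega) (fun i => c i * (((k : ℝ) + 1) * (ξ (i + k + 1) - ξ i)⁻¹) -
        c (i - 1) * (((k : ℝ) + 1) * (ξ (i - 1 + k + 2) - ξ (i - 1 + 1))⁻¹)) (by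
          rw [← hd]
          refine Finset.sum_congr rfl fun i _ => ?_
          simp only [map_sub, map_mul]
          ring) i h1 h2
      have h3 := hξ (show i ≤ m by omega)
      have h4 := hξ (show m + 1 ≤ i + k + 1 by omega)
      have h5 : (ξ (i + k + 1) - ξ i)⁻¹ ≠ 0 := inv_ne_zero (by linarith)
      have h6 : ((k : ℝ) + 1) ≠ 0 := by positivity
      rw [show i - 1 + k + 2 = i + k + 1 by omega, show i - 1 + 1 = i by omega, ← sub_mul] at hz
      have := (mul_eq_zero.1 hz).resolve_right (mul_ne_zero h6 h5)
      linarith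
    have hconst : ∀ j, j ≤ k + 1 → c (m - j) = c m := by
      intro j
      induction j with
      | zero => intro _; rfl
      | succ j ihj =>
        intro hj
        rw [← ihj (by omega), hstep (m - j) (by omega) (by omega)]
        rfl
    have hsum : ∑ i ∈ Finset.range M, Polynomial.C (c i) * coxDeBoorPiece ξ m (k + 1) i =
        Polynomial.C (c m) := by
      rw [← mul_one (Polynomial.C (c m)), ← sum_coxDeBoorPiece hξ hm hM (k + 1) hk,
        Finset.mul_sum]
      refine Finset.sum_congr rfl fun i _ => ?_
      by_cases h : m < i ∨ i + (k + 1) < m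
      · simp [coxDeBoorPiece_eq_zero ξ m (k + 1) i h]
      · have := hconst (m - i) (by omega)
        rw [show m - (m - i) = i by omega] at this
        rw [this]
    rw [h] at hsum
    have hcm : c m = 0 := by simpa using hsum.symm
    have := hconst (m - i) (by omega)
    rw [show m - (m - i) = i by omega] at this
    rw [this, hcm]

/-! ### Values and derivatives at a multiple knot -/

/-- The value at `ζ = ξ m`, from the right, if `ζ` is a knot of multiplicity at least `k`. -/
theorem eval_coxDeBoorPiece_right {ξ : ℕ → ℝ} {ζ : ℝ} {m : ℕ} (hm : ζ < ξ (m + 1)) (k : ℕ) :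
    k ≤ m → (∀ j, m < j + k → j ≤ m → ξ j = ζ) → ∀ i,
    (coxDeBoorPiece ξ m k i).eval ζ = if i + k = m then 1 else 0 := by
  induction k with
  | zero =>
    intro _ _ i
    simp only [coxDeBoorPiece]
    split_ifs <;> simp_all
  | succ k ih =>
    intro hk h i
    simp only [coxDeBoorPiece, Polynomial.eval_add, Polynomial.eval_mul,
      Polynomial.eval_C, Polynomial.eval_sub, Polynomial.eval_X,
      ih (by omega) (fun j h1 h2 => h j (by omega) h2)]
    have e1 : (ξ (i + k + 1) - ξ i)⁻¹ * (ζ - ξ i) * (if i + k = m then 1 else 0) = 0 := by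
      split_ifs with hi
      · rw [h i (by omega) (by omega)]; simp
      · simp
    rw [e1, zero_add]
    by_cases hi : i + (k + 1) = m
    · rw [if_pos hi, if_pos (by omega), h (i + 1) (by omega) (by omega), mul_one,
        show i + k + 2 = m + 1 by omega]
      exact inv_mul_cancel₀ (by linarith)
    · rw [if_neg hi, if_neg (by omega), mul_zero]

/-- The value at `ζ = ξ (m + 1)`, from the left, if `ζ` is a knot of multiplicity at least `k`. -/
theorem eval_coxDeBoorPiece_left {ξ : ℕ → ℝ} {ζ : ℝ} {m : ℕ} (hm : ξ m < ζ) (k : ℕ) :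
    (∀ j, m < j → j ≤ m + k → ξ j = ζ) → ∀ i,
    (coxDeBoorPiece ξ m k i).eval ζ = if i = m then 1 else 0 := by
  induction k with
  | zero =>
    intro _ i
    simp only [coxDeBoorPiece]
    split_ifs <;> simp
  | succ k ih =>
    intro h i
    simp only [coxDeBoorPiece, Polynomial.eval_add, Polynomial.eval_mul,
      Polynomial.eval_C, Polynomial.eval_sub, Polynomial.eval_X,
      ih (fun j h1 h2 => h j h1 (by omega))]
    have e1 : (ξ (i + k + 2) - ξ (i + 1))⁻¹ * (ξ (i + k + 2) - ζ) *
        (if i + 1 = m then 1 else 0) = 0 := by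
      split_ifs with hi
      · rw [h (i + k + 2) (by omega) (by omega)]; simp
      · simp
    rw [e1, add_zero]
    by_cases hi : i = m
    · rw [if_pos hi, hi, h (m + k + 1) (by omega) (by omega), mul_one]
      exact inv_mul_cancel₀ (by linarith)
    · rw [if_neg hi, mul_zero]

/-- At a knot of multiplicity `ℓ`, the derivatives of order `r` of the B-splines of degree `ℓ + r`
are continuous. -/
theorem eval_iterate_derivative_coxDeBoorPiece_eq {ξ : ℕ → ℝ} (hξ : Monotone ξ) {ζ : ℝ}
    {m ℓ : ℕ} (hleft : ξ m < ζ) (hright : ζ < ξ (m + ℓ + 1))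
    (h : ∀ j, m < j → j ≤ m + ℓ → ξ j = ζ) (r : ℕ) : ∀ i,
    (Polynomial.derivative^[r] (coxDeBoorPiece ξ (m + ℓ) (ℓ + r) i)).eval ζ =
      (Polynomial.derivative^[r] (coxDeBoorPiece ξ m (ℓ + r) i)).eval ζ := by
  induction r with
  | zero =>
    intro i
    simp only [Function.iterate_zero, id_eq, add_zero]
    rw [eval_coxDeBoorPiece_left hleft ℓ h, eval_coxDeBoorPiece_right hright ℓ (by omega)
      (fun j h1 h2 => h j (by omega) h2)]
    simp
  | succ r ih =>
    intro i
    simp only [Function.iterate_succ, Function.comp_apply]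
    rw [← add_assoc, derivative_coxDeBoorPiece hξ, derivative_coxDeBoorPiece hξ]
    simp only [Polynomial.iterate_derivative_sub, Polynomial.iterate_derivative_C_mul,
      Polynomial.eval_sub, Polynomial.eval_mul, Polynomial.eval_C, ih]

/-- The derivative of order `r` of a B-spline whose first knot has the multiplicity `ℓ + 1`. -/
theorem eval_iterate_derivative_coxDeBoorPiece_first {ξ : ℕ → ℝ} (hξ : Monotone ξ) {ζ : ℝ}
    {m ℓ : ℕ} (hright : ζ < ξ (m + ℓ + 1))
    (h : ∀ j, m ≤ j → j ≤ m + ℓ → ξ j = ζ) (r : ℕ) : ∀ i, m ≤ i →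
    (Polynomial.derivative^[r] (coxDeBoorPiece ξ (m + ℓ) (ℓ + r) i)).eval ζ =
      if i = m then ((ℓ + r).factorial : ℝ) / ℓ.factorial *
        (∏ k ∈ Finset.Icc (m + ℓ + 1) (m + ℓ + r), (ξ k - ζ))⁻¹ else 0 := by
  induction r with
  | zero =>
    intro i hi
    simp only [Function.iterate_zero, id_eq, add_zero]
    rw [eval_coxDeBoorPiece_right hright ℓ (by omega) (fun j h1 h2 => h j (by omega) h2)]
    have : ((ℓ.factorial : ℝ)) ≠ 0 := by positivity
    simp [this]
  | succ r ih =>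
    intro i hi
    simp only [Function.iterate_succ, Function.comp_apply]
    rw [← add_assoc, derivative_coxDeBoorPiece hξ]
    simp only [Polynomial.iterate_derivative_sub, Polynomial.iterate_derivative_C_mul,
      Polynomial.eval_sub, Polynomial.eval_mul, Polynomial.eval_C, ih i hi, ih (i + 1) (by omega)]
    rw [if_neg (show ¬ i + 1 = m by omega), mul_zero, sub_zero]
    by_cases him : i = m
    · subst him
      rw [if_pos rfl, if_pos rfl, show i + ℓ + (r + 1) = i + ℓ + r + 1 by ring,
        ← Finset.insert_Icc_right_eq_Icc_add_one (by omega), Finset.prod_insert (by simp), Nat.factorial_succ,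
        h i le_rfl (by omega), mul_inv, show i + (ℓ + r) + 1 = i + ℓ + r + 1 by ring]
      push_cast
      ring
    · rw [if_neg him, if_neg him, mul_zero]

/-! ### Jumps of derivatives of piecewise polynomials -/

theorem iteratedDeriv_polynomial_eval (P : Polynomial ℝ) (r : ℕ) :
    iteratedDeriv r (fun x => P.eval x) = fun x => (Polynomial.derivative^[r] P).eval x := by
  induction r with
  | zero => simp
  | succ r ih =>
    rw [iteratedDeriv_succ, ih]
    funext x
    rw [Polynomial.deriv, Function.iterate_succ_apply']

/-- Since `U` is open, `s` agrees with `P` in a full neighbourhood of each nearby point of `U`, so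
the two-sided derivatives agree there; the value of `s` at `ζ` plays no role. -/
theorem tendsto_iteratedDeriv_of_eventually_eq_eval {s : ℝ → ℝ} {ζ : ℝ} {U : Set ℝ}
    (hU : IsOpen U) {P : Polynomial ℝ} (h : ∀ᶠ x in 𝓝[U] ζ, s x = P.eval x) (r : ℕ) :
    Tendsto (iteratedDeriv r s) (𝓝[U] ζ) (𝓝 ((Polynomial.derivative^[r] P).eval ζ)) := by
  have h1 : Tendsto (fun x => (Polynomial.derivative^[r] P).eval x) (𝓝[U] ζ)
      (𝓝 ((Polynomial.derivative^[r] P).eval ζ)) :=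
    (Polynomial.continuous _).continuousWithinAt
  refine h1.congr' ?_
  filter_upwards [eventually_eventually_nhdsWithin.2 h, self_mem_nhdsWithin] with x hx hxU
  rw [hU.nhdsWithin_eq hxU] at hx
  rw [Filter.EventuallyEq.iteratedDeriv_eq r (g := fun x => P.eval x) hx,
    iteratedDeriv_polynomial_eval]

/-- On each side of `ζ` the function `s` agrees with a polynomial, and `J` is the jump of the
derivative of order `r` at `ζ`. -/
def HasPolynomialJump (r : ℕ) (s : ℝ → ℝ) (ζ J : ℝ) : Prop :=
  ∃ P Q : Polynomial ℝ, (∀ᶠ x in 𝓝[>] ζ, s x = P.eval x) ∧ (∀ᶠ x in 𝓝[<] ζ, s x = Q.eval x) ∧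
    J = (Polynomial.derivative^[r] P).eval ζ - (Polynomial.derivative^[r] Q).eval ζ

namespace HasPolynomialJump

variable {r : ℕ} {s t : ℝ → ℝ} {ζ J J' : ℝ}

theorem hasJump (h : HasPolynomialJump r s ζ J) : HasJump (iteratedDeriv r s) ζ J := by
  obtain ⟨P, Q, hP, hQ, rfl⟩ := h
  exact ⟨_, _, tendsto_iteratedDeriv_of_eventually_eq_eval isOpen_Ioi hP r,
    tendsto_iteratedDeriv_of_eventually_eq_eval isOpen_Iio hQ r, rfl⟩

theorem unique (h : HasPolynomialJump r s ζ J) (h' : HasPolynomialJump r s ζ J') : J = J' := by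
  obtain ⟨R, L, hR, hL, rfl⟩ := h.hasJump
  obtain ⟨R', L', hR', hL', rfl⟩ := h'.hasJump
  rw [tendsto_nhds_unique hR hR', tendsto_nhds_unique hL hL']

theorem zero : HasPolynomialJump r (0 : ℝ → ℝ) ζ 0 :=
  ⟨0, 0, by simp, by simp, by simp⟩

theorem add (h : HasPolynomialJump r s ζ J) (h' : HasPolynomialJump r t ζ J') :
    HasPolynomialJump r (s + t) ζ (J + J') := by
  obtain ⟨P, Q, hP, hQ, rfl⟩ := h
  obtain ⟨P', Q', hP', hQ', rfl⟩ := h'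
  refine ⟨P + P', Q + Q', ?_, ?_, ?_⟩
  · filter_upwards [hP, hP'] with x h1 h2
    simp [h1, h2]
  · filter_upwards [hQ, hQ'] with x h1 h2
    simp [h1, h2]
  · simp only [iterate_map_add, Polynomial.eval_add]
    ring

theorem const_smul (c : ℝ) (h : HasPolynomialJump r s ζ J) :
    HasPolynomialJump r (c • s) ζ (c * J) := by
  obtain ⟨P, Q, hP, hQ, rfl⟩ := h
  refine ⟨Polynomial.C c * P, Polynomial.C c * Q, ?_, ?_, ?_⟩
  · filter_upwards [hP] with x h1
    simp [h1]
  · filter_upwards [hQ] with x h1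
    simp [h1]
  · simp only [Polynomial.iterate_derivative_C_mul, Polynomial.eval_mul, Polynomial.eval_C]
    ring

theorem sum {ι : Type*} (A : Finset ι) {f : ι → ℝ → ℝ} {K : ι → ℝ}
    (h : ∀ i, HasPolynomialJump r (f i) ζ (K i)) :
    HasPolynomialJump r (∑ i ∈ A, f i) ζ (∑ i ∈ A, K i) := by
  classical
  induction A using Finset.induction_on with
  | empty => simpa using zero
  | insert i A hi ih =>
    rw [Finset.sum_insert hi, Finset.sum_insert hi]
    exact (h i).add ih

end HasPolynomialJump

theorem hasPolynomialJump_bspline {ξ : ℕ → ℝ} (hξ : Monotone ξ) {p n : ℕ} {ζ : ℝ}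
    (hζ : ζ ∈ Set.Ioo (ξ (p + 1)) (ξ (n + 1))) {m m' : ℕ} (h1 : ξ m ≤ ζ) (h2 : ζ < ξ (m + 1))
    (h3 : ξ m' < ζ) (h4 : ζ ≤ ξ (m' + 1)) (r i : ℕ) :
    HasPolynomialJump r (bspline p n ξ i) ζ
      ((Polynomial.derivative^[r] (coxDeBoorPiece ξ m p i)).eval ζ -
        (Polynomial.derivative^[r] (coxDeBoorPiece ξ m' p i)).eval ζ) := by
  refine ⟨_, _, ?_, ?_, rfl⟩
  · filter_upwards [Ioo_mem_nhdsGT h2, Ioo_mem_nhdsGT hζ.2] with x hx hx'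
    rw [bspline, Set.indicator_of_mem
      (show x ∈ Set.Icc _ _ from ⟨(hζ.1.trans hx.1).le, hx'.2.le⟩)]
    exact coxDeBoor_eq_eval_piece hξ (h1.trans_lt hx.1) hx.2 hx'.2 p i
  · filter_upwards [Ioo_mem_nhdsLT h3, Ioo_mem_nhdsLT hζ.1] with x hx hx'
    rw [bspline, Set.indicator_of_mem
      (show x ∈ Set.Icc _ _ from ⟨hx'.1.le, (hx'.2.trans hζ.2).le⟩)]
    exact coxDeBoor_eq_eval_piece hξ hx.1 (hx.2.trans_le h4) (hx'.2.trans hζ.2) p i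

/-! ### B-splines of the coarse knot vector -/

section RemoveKnot

variable {ξ : ℕ → ℝ} {p n i₀ : ℕ}

theorem bspline_removeKnot (hp : p + 1 < i₀) (hn : i₀ ≤ n) (i : ℕ) :
    bspline p (n - 1) (removeKnot ξ i₀) i =
      (Set.Icc (ξ (p + 1)) (ξ (n + 1))).indicator
        (coxDeBoor (removeKnot ξ i₀) (ξ (n + 1)) p i) := by
  rw [bspline, removeKnot_of_lt hp, removeKnot_of_le (show i₀ ≤ n - 1 + 1 by omega),
    show n - 1 + 1 = n by omega]

theorem bspline_removeKnot_of_lt (hp : p + 1 < i₀) (hn : i₀ ≤ n) {i : ℕ} (h : i + p + 1 < i₀) :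
    bspline p (n - 1) (removeKnot ξ i₀) i = bspline p n ξ i := by
  rw [bspline_removeKnot hp hn, bspline]
  congr 1
  exact funext fun x => coxDeBoor_removeKnot_of_lt _ x h

theorem bspline_removeKnot_of_le (hp : p + 1 < i₀) (hn : i₀ ≤ n) {i : ℕ} (h : i₀ ≤ i) :
    bspline p (n - 1) (removeKnot ξ i₀) i = bspline p n ξ (i + 1) := by
  rw [bspline_removeKnot hp hn, bspline]
  congr 1
  exact funext fun x => coxDeBoor_removeKnot_of_le _ x h

theorem bspline_removeKnot_eq (hξ : Monotone ξ) (hp : p + 1 < i₀) (hn : i₀ ≤ n) {i : ℕ}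
    (h1 : i < i₀) (h2 : i₀ ≤ i + p + 1) :
    bspline p (n - 1) (removeKnot ξ i₀) i =
      ((ξ i₀ - ξ i) / (ξ (i + p + 1) - ξ i)) • bspline p n ξ i +
      ((ξ (i + p + 2) - ξ i₀) / (ξ (i + p + 2) - ξ (i + 1))) • bspline p n ξ (i + 1) := by
  rw [bspline_removeKnot hp hn, bspline, bspline]
  funext x
  by_cases hx : x ∈ Set.Icc (ξ (p + 1)) (ξ (n + 1))
  · simp only [Pi.add_apply, Pi.smul_apply, smul_eq_mul, Set.indicator_of_mem hx]
    rw [coxDeBoor_removeKnot hξ _ x p i h1 h2]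
    ring
  · simp [Set.indicator_of_notMem hx]

end RemoveKnot

/-! ### Dependence on the relevant knots, and uniqueness of control points -/

theorem bspline_congr {ξ ξ' : ℕ → ℝ} {p n : ℕ} (h : ∀ i ∈ Set.Icc 1 (n + p + 1), ξ i = ξ' i)
    {i : ℕ} (hi : i ∈ Set.Icc 1 n) : bspline p n ξ i = bspline p n ξ' i := by
  rw [bspline, bspline, h (p + 1) ⟨by omega, by omega⟩, h (n + 1) ⟨by omega, by omega⟩]
  congr 1
  obtain ⟨h1, h2⟩ := hi
  exact funext fun x => coxDeBoor_congr _ x p i fun j _ _ => h j ⟨by omega, by omega⟩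

theorem splineSpace_congr {ξ ξ' : ℕ → ℝ} {p n : ℕ}
    (h : ∀ i ∈ Set.Icc 1 (n + p + 1), ξ i = ξ' i) : splineSpace p n ξ = splineSpace p n ξ' := by
  rw [splineSpace, splineSpace, Set.image_congr fun i hi => bspline_congr h hi]

theorem xiNorm_congr {ξ ξ' : ℕ → ℝ} {p n : ℕ}
    (h : ∀ i ∈ Set.Icc 1 (n + p + 1), ξ i = ξ' i) : xiNorm p n ξ = xiNorm p n ξ' := by
  have h1 : IsControlPoints p n ξ = IsControlPoints p n ξ' := by
    funext f c
    simp only [IsControlPoints]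
    rw [Finset.sum_congr rfl fun (i : Fin n) _ =>
      congrArg (c i • ·) (bspline_congr h (show (i : ℕ) + 1 ∈ Set.Icc 1 n from
        ⟨by omega, i.2⟩))]
  funext f
  simp only [xiNorm, controlPoints, h1]
  congr 1
  refine Finset.sum_congr rfl fun i _ => ?_
  rw [h (i + 1 + p + 1) ⟨by omega, by omega⟩, h (i + 1) ⟨by omega, by omega⟩]

theorem mem_splineSpace_iff {ξ : ℕ → ℝ} {p n : ℕ} {s : ℝ → ℝ} :
    s ∈ splineSpace p n ξ ↔ ∃ c : Fin n → ℝ, IsControlPoints p n ξ s c := by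
  have : bspline p n ξ '' Set.Icc 1 n = Set.range fun i : Fin n => bspline p n ξ (i + 1) := by
    ext f
    constructor
    · rintro ⟨i, ⟨h1, h2⟩, rfl⟩
      exact ⟨⟨i - 1, by omega⟩, by simp [Nat.sub_add_cancel h1]⟩
    · rintro ⟨i, rfl⟩
      exact ⟨i + 1, ⟨by omega, i.2⟩, rfl⟩
  rw [splineSpace, this, Submodule.mem_span_range_iff_exists_fun]
  exact exists_congr fun c => eq_comm

/-- The control points of a spline are unique. -/
theorem linearIndependent_bspline {ξ : ℕ → ℝ} (hξ : Monotone ξ) {p n : ℕ}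
    (hb : IsBasicKnotVector p n ξ) :
    LinearIndependent ℝ fun i : Fin n => bspline p n ξ (i + 1) := by
  rw [Fintype.linearIndependent_iff]
  intro c hc i
  -- One nondegenerate knot interval of `[a, b]` inside the support is enough. Below it is the first
  -- or last interval of `[a, b]`, or one provided by `ξ_i < ξ_{i+p+1}`.
  have hloc : ∀ m, p + 1 ≤ m → m ≤ n → ξ m < ξ (m + 1) → (i : ℕ) + 1 ≤ m → m ≤ i + 1 + p →
      c i = 0 := by
    intro m h1 h2 hm h3 h4
    let d : ℕ → ℝ := fun j => if h : j < n then c ⟨j, h⟩ else 0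
    have hP : ∑ j : Fin n, Polynomial.C (c j) * coxDeBoorPiece ξ m p (j + 1) = 0 := by
      refine Polynomial.eq_zero_of_infinite_isRoot _ ((Set.Ioo_infinite hm).mono ?_)
      intro x hx
      have hx2 : x < ξ (n + 1) := hx.2.trans_le (hξ (by omega))
      have hx1 : ξ (p + 1) ≤ x := (hξ h1).trans hx.1.le
      have := congrFun hc x
      simp only [Finset.sum_apply, Pi.smul_apply, smul_eq_mul, bspline,
        Set.indicator_of_mem (show x ∈ Set.Icc (ξ (p + 1)) (ξ (n + 1)) from ⟨hx1, hx2.le⟩),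
        coxDeBoor_eq_eval_piece hξ hx.1 hx.2 hx2, Pi.zero_apply] at this
      simpa [Polynomial.IsRoot, Polynomial.eval_finsetSum] using this
    have hQ : ∑ j ∈ Finset.range (n + 1), Polynomial.C (d (j - 1)) * coxDeBoorPiece ξ m p j
        = 0 := by
      rw [Finset.sum_range_succ', coxDeBoorPiece_eq_zero ξ m p 0 (by omega), mul_zero, add_zero,
        Finset.sum_range, ← hP]
      refine Finset.sum_congr rfl fun j _ => ?_
      simp [d]
    have := eq_zero_of_sum_coxDeBoorPiece_eq_zero hξ hm (show m < n + 1 by omega) p (by omega)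
      (fun j => d (j - 1)) hQ (i + 1) h3 h4
    simpa [d] using this
  have hi := i.2
  rcases Nat.lt_or_ge p i with h1 | h1
  · rcases Nat.lt_or_ge n (i + 1 + p + 1) with h2 | h2
    · exact hloc n hb.le_dim le_rfl hb.lt_right (by omega) (by omega)
    · by_contra hne
      have hstep : ∀ k, k ≤ p + 1 → ξ (i + 1 + k) ≤ ξ (i + 1) := by
        intro k
        induction k with
        | zero => intro _; exact le_rfl
        | succ k ih =>
          intro hk
          refine le_trans (not_lt.1 fun hlt => hne ?_) (ih (by omega))
          exact hloc (i + 1 + k) (by omega) (by omega) hlt (by omega) (by omega)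
      exact absurd (hb.lt_add (i + 1) (by omega) (by omega)) (not_lt.2 (hstep (p + 1) le_rfl))
  · exact hloc (p + 1) le_rfl hb.le_dim hb.left_lt (by omega) (by omega)

theorem IsControlPoints.controlPoints_eq {ξ : ℕ → ℝ} (hξ : Monotone ξ) {p n : ℕ}
    (hb : IsBasicKnotVector p n ξ) {s : ℝ → ℝ} {c : Fin n → ℝ} (h : IsControlPoints p n ξ s c) :
    controlPoints p n ξ s = c := by
  have h' : IsControlPoints p n ξ s (controlPoints p n ξ s) := Classical.epsilon_spec ⟨c, h⟩
  have hli := linearIndependent_bspline hξ hb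
  funext i
  have h2 := Fintype.linearIndependent_iff.1 hli (controlPoints p n ξ s - c) (by
    simp only [Pi.sub_apply, sub_smul, Finset.sum_sub_distrib]
    exact sub_eq_zero.2 (h'.symm.trans h)) i
  exact sub_eq_zero.1 h2

/-! ### The jump functional and its coefficients -/

/-- `ξ i₀` is an interior breakpoint of multiplicity `ℓ + 1`, and `i₀` is the last index at which
it occurs. -/
structure IsLastInteriorKnot (p n ℓ : ℕ) (ξ : ℕ → ℝ) (i₀ : ℕ) : Prop where
  le_index : p + ℓ + 2 ≤ i₀
  index_le : i₀ ≤ n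
  le_degree : ℓ ≤ p
  lt_knot : ξ (i₀ - ℓ - 1) < ξ i₀
  knot_eq : ∀ j, i₀ - ℓ ≤ j → j ≤ i₀ → ξ j = ξ i₀
  knot_lt : ξ i₀ < ξ (i₀ + 1)

/-- The jump at `ξ i₀` of the derivative of order `p - ℓ` of the `i`-th B-spline. -/
noncomputable def jumpCoeff (p ℓ : ℕ) (ξ : ℕ → ℝ) (i₀ i : ℕ) : ℝ :=
  (Polynomial.derivative^[p - ℓ] (coxDeBoorPiece ξ i₀ p i)).eval (ξ i₀) -
    (Polynomial.derivative^[p - ℓ] (coxDeBoorPiece ξ (i₀ - ℓ - 1) p i)).eval (ξ i₀)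

namespace IsLastInteriorKnot

variable {p n ℓ : ℕ} {ξ : ℕ → ℝ} {i₀ : ℕ}

theorem knot_mem_Ioo (h : IsLastInteriorKnot p n ℓ ξ i₀) (hξ : Monotone ξ) :
    ξ i₀ ∈ Set.Ioo (ξ (p + 1)) (ξ (n + 1)) := by
  have h1 := h.le_index
  have h2 := h.index_le
  exact ⟨(hξ (by omega)).trans_lt h.lt_knot, h.knot_lt.trans_le (hξ (by omega))⟩

theorem hasPolynomialJump_bspline (h : IsLastInteriorKnot p n ℓ ξ i₀) (hξ : Monotone ξ) (i : ℕ) :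
    HasPolynomialJump (p - ℓ) (bspline p n ξ i) (ξ i₀) (jumpCoeff p ℓ ξ i₀ i) := by
  have h1 := h.le_index
  exact _root_.hasPolynomialJump_bspline hξ (h.knot_mem_Ioo hξ) le_rfl h.knot_lt h.lt_knot
    (h.knot_eq _ (by omega) (by omega)).ge _ i

theorem hasPolynomialJump_bspline_removeKnot (h : IsLastInteriorKnot p n ℓ ξ i₀)
    (hξ : Monotone ξ) (i : ℕ) :
    HasPolynomialJump (p - ℓ) (bspline p (n - 1) (removeKnot ξ i₀) i) (ξ i₀) 0 := by
  have h1 := h.le_index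
  have h2 := h.index_le
  obtain ⟨r, hr⟩ := Nat.exists_eq_add_of_le h.le_degree
  obtain ⟨m, hm⟩ := Nat.exists_eq_add_of_le (show ℓ + 1 ≤ i₀ by omega)
  have hτ := monotone_removeKnot hξ i₀
  have hI : ξ i₀ ∈ Set.Ioo (removeKnot ξ i₀ (p + 1)) (removeKnot ξ i₀ (n - 1 + 1)) := by
    rw [removeKnot_of_lt (by omega), removeKnot_of_le (by omega), show n - 1 + 1 = n by omega]
    exact h.knot_mem_Ioo hξ
  have hl : removeKnot ξ i₀ m < ξ i₀ := by
    rw [removeKnot_of_lt (by omega), show m = i₀ - ℓ - 1 by omega]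
    exact h.lt_knot
  have hr' : ξ i₀ < removeKnot ξ i₀ (m + ℓ + 1) := by
    rw [removeKnot_of_le (by omega), show m + ℓ + 1 = i₀ by omega]
    exact h.knot_lt
  have he : ∀ j, m < j → j ≤ m + ℓ → removeKnot ξ i₀ j = ξ i₀ := fun j _ _ => by
    rw [removeKnot_of_lt (by omega), h.knot_eq j (by omega) (by omega)]
  -- For `ℓ = 0` the point `ζ` is no longer a knot, and the same polynomial piece lies on both
  -- sides.
  have hle : ξ i₀ ≤ removeKnot ξ i₀ (m + 1) := by
    rcases Nat.eq_zero_or_pos ℓ with h0 | h0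
    · subst h0
      exact hr'.le
    · rw [he (m + 1) (by omega) (by omega)]
  have hge : removeKnot ξ i₀ (m + ℓ) ≤ ξ i₀ := by
    rcases Nat.eq_zero_or_pos ℓ with h0 | h0
    · subst h0
      exact hl.le
    · rw [he (m + ℓ) (by omega) (by omega)]
  have key := _root_.hasPolynomialJump_bspline hτ hI hge hr' hl hle r i
  subst hr
  rwa [eval_iterate_derivative_coxDeBoorPiece_eq hτ hl hr' he, sub_self,
    show r = ℓ + r - ℓ by omega, show ℓ + (ℓ + r - ℓ) = ℓ + r by omega] at key

/-- These B-splines vanish to the left of `ζ`, so the jump is the right derivative; only the one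
starting with all `ℓ + 1` copies of `ζ` is rough enough to have one. -/
theorem jumpCoeff_of_le (h : IsLastInteriorKnot p n ℓ ξ i₀) (hξ : Monotone ξ) {i : ℕ}
    (hi : i₀ - ℓ ≤ i) : jumpCoeff p ℓ ξ i₀ i = if i = i₀ - ℓ then (p.factorial : ℝ) / ℓ.factorial *
      (∏ k ∈ Finset.Icc (i₀ + 1) (i₀ + (p - ℓ)), (ξ k - ξ i₀))⁻¹ else 0 := by
  have h1 := h.le_index
  obtain ⟨r, rfl⟩ := Nat.exists_eq_add_of_le h.le_degree
  have e : i₀ - ℓ + ℓ = i₀ := by omega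
  have key := eval_iterate_derivative_coxDeBoorPiece_first hξ (ζ := ξ i₀) (m := i₀ - ℓ) (ℓ := ℓ)
    (by rw [e]; exact h.knot_lt) (fun j h3 h4 => h.knot_eq j h3 (by omega)) r i hi
  rw [e] at key
  rw [jumpCoeff, coxDeBoorPiece_eq_zero ξ (i₀ - ℓ - 1) (ℓ + r) i (by omega),
    show ℓ + r - ℓ = r by omega, key]
  simp

/-- Such a B-spline does not use the removed knot, so it is also a coarse B-spline. -/
theorem jumpCoeff_of_lt (h : IsLastInteriorKnot p n ℓ ξ i₀) (hξ : Monotone ξ) {i : ℕ}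
    (hi : i + p + 1 < i₀) : jumpCoeff p ℓ ξ i₀ i = 0 := by
  have h1 := h.le_index
  have key := h.hasPolynomialJump_bspline_removeKnot hξ i
  rw [bspline_removeKnot_of_lt (by omega) h.index_le hi] at key
  exact (h.hasPolynomialJump_bspline hξ i).unique key

theorem jumpCoeff_recurrence (h : IsLastInteriorKnot p n ℓ ξ i₀) (hξ : Monotone ξ) {i : ℕ}
    (hi : i < i₀) (hi' : i₀ ≤ i + p + 1) :
    (ξ i₀ - ξ i) / (ξ (i + p + 1) - ξ i) * jumpCoeff p ℓ ξ i₀ i +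
      (ξ (i + p + 2) - ξ i₀) / (ξ (i + p + 2) - ξ (i + 1)) * jumpCoeff p ℓ ξ i₀ (i + 1) = 0 := by
  have h1 := h.le_index
  have key := h.hasPolynomialJump_bspline_removeKnot hξ i
  rw [bspline_removeKnot_eq hξ (by omega) h.index_le hi hi'] at key
  exact (((h.hasPolynomialJump_bspline hξ i).const_smul _).add
    ((h.hasPolynomialJump_bspline hξ (i + 1)).const_smul _)).unique key

/-- The recurrence reads `κ_i = -μ_j κ_{i+1}`; squaring drops the sign, and only squares enter the
norm. -/
theorem jumpCoeff_sq_eq_muCoeff (h : IsLastInteriorKnot p n ℓ ξ i₀) (hξ : Monotone ξ)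
    (hb : IsBasicKnotVector p n ξ) {j : ℕ} (h1 : 1 ≤ j) (h2 : j ≤ p + 1 - ℓ) :
    jumpCoeff p ℓ ξ i₀ (i₀ + j - (p + 2)) ^ 2 =
      muCoeff p ξ i₀ j ^ 2 * jumpCoeff p ℓ ξ i₀ (i₀ + j - (p + 2) + 1) ^ 2 := by
  have h3 := h.le_index
  have h4 := h.index_le
  have h5 := h.le_degree
  obtain ⟨i, hi⟩ : ∃ i, i = i₀ + j - (p + 2) := ⟨_, rfl⟩
  have key := h.jumpCoeff_recurrence hξ (i := i) (by omega) (by omega)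
  rw [muCoeff, insertionCoeff, insertionCoeff, show i₀ + (j + 1) - (p + 2) = i + 1 by omega,
    show i₀ + (j + 1) - 1 = i + p + 2 by omega, show i₀ + j - 1 = i + p + 1 by omega, ← hi]
  have l1 : ξ i < ξ i₀ := (hξ (by omega)).trans_lt h.lt_knot
  have l2 : ξ i₀ ≤ ξ (i + p + 1) := hξ (by omega)
  have l3 := hb.lt_add (i + 1) (by omega) (by omega)
  rw [show i + 1 + p + 1 = i + p + 2 by ring] at l3
  have n1 : (ξ i₀ - ξ i) / (ξ (i + p + 1) - ξ i) ≠ 0 :=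
    div_ne_zero (by linarith) (by linarith)
  have n3 : ξ (i + p + 2) - ξ (i + 1) ≠ 0 := by linarith
  have e : 1 - (ξ i₀ - ξ (i + 1)) / (ξ (i + p + 2) - ξ (i + 1)) =
      (ξ (i + p + 2) - ξ i₀) / (ξ (i + p + 2) - ξ (i + 1)) := by
    field_simp
    ring
  rw [e, ← mul_pow, ← neg_sq (_ * jumpCoeff p ℓ ξ i₀ (i + 1))]
  congr 1
  rw [div_mul_eq_mul_div, ← neg_div, eq_div_iff n1]
  linear_combination key

theorem jumpCoeff_sq_eq_prod (h : IsLastInteriorKnot p n ℓ ξ i₀) (hξ : Monotone ξ)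
    (hb : IsBasicKnotVector p n ξ) (d : ℕ) (hd : d ≤ p + 1 - ℓ) :
    jumpCoeff p ℓ ξ i₀ (i₀ + (p + 2 - ℓ - d) - (p + 2)) ^ 2 =
      (∏ i ∈ Finset.Icc (p + 2 - ℓ - d) (p + 1 - ℓ), muCoeff p ξ i₀ i ^ 2) *
        jumpCoeff p ℓ ξ i₀ (i₀ - ℓ) ^ 2 := by
  have h3 := h.le_index
  have h5 := h.le_degree
  induction d with
  | zero =>
    rw [Finset.Icc_eq_empty (by omega), Finset.prod_empty, one_mul,
      show i₀ + (p + 2 - ℓ - 0) - (p + 2) = i₀ - ℓ by omega]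
  | succ d ih =>
    rw [h.jumpCoeff_sq_eq_muCoeff hξ hb (by omega) (by omega),
      ← Finset.insert_Icc_add_one_left_eq_Icc (show p + 2 - ℓ - (d + 1) ≤ p + 1 - ℓ by omega),
      Finset.prod_insert (by simp), mul_assoc,
      show i₀ + (p + 2 - ℓ - (d + 1)) - (p + 2) + 1 = i₀ + (p + 2 - ℓ - d) - (p + 2) by omega,
      show p + 2 - ℓ - (d + 1) + 1 = p + 2 - ℓ - d by omega, ih (by omega)]

theorem prod_knot_sub_pos (h : IsLastInteriorKnot p n ℓ ξ i₀) (hξ : Monotone ξ) :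
    0 < ∏ k ∈ Finset.Icc (i₀ + 1) (i₀ + (p - ℓ)), (ξ k - ξ i₀) :=
  Finset.prod_pos fun _ hk => sub_pos.2 (h.knot_lt.trans_le (hξ (Finset.mem_Icc.1 hk).1))

theorem jumpCoeff_last_pos (h : IsLastInteriorKnot p n ℓ ξ i₀) (hξ : Monotone ξ) :
    0 < jumpCoeff p ℓ ξ i₀ (i₀ - ℓ) := by
  rw [h.jumpCoeff_of_le hξ le_rfl, if_pos rfl]
  have := h.prod_knot_sub_pos hξ
  positivity

/-! ### The norm of the jump functional and the constant -/

theorem localWeight_sq (h : IsLastInteriorKnot p n ℓ ξ i₀) (hb : IsBasicKnotVector p n ξ) {j : ℕ}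
    (h1 : 1 ≤ j) (h2 : j ≤ p + 2 - ℓ) :
    localWeight p ξ i₀ j ^ 2 =
      (ξ (i₀ + j - (p + 2) + p + 1) - ξ (i₀ + j - (p + 2))) / (p + 1) := by
  have h3 := h.le_index
  have h4 := h.index_le
  have h5 := h.le_degree
  have := hb.lt_add (i₀ + j - (p + 2)) (by omega) (by omega)
  rw [localWeight, knotWeight, Real.sq_sqrt]
  exact div_nonneg (by linarith) (by positivity)

theorem localWeight_pos (h : IsLastInteriorKnot p n ℓ ξ i₀) (hb : IsBasicKnotVector p n ξ) {j : ℕ}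
    (h1 : 1 ≤ j) (h2 : j ≤ p + 2 - ℓ) : 0 < localWeight p ξ i₀ j := by
  have h3 := h.le_index
  have h4 := h.index_le
  have h5 := h.le_degree
  have := hb.lt_add (i₀ + j - (p + 2)) (by omega) (by omega)
  exact Real.sqrt_pos.2 (div_pos (by linarith) (by positivity))

theorem sum_jumpCoeff_sq_div (h : IsLastInteriorKnot p n ℓ ξ i₀) (hξ : Monotone ξ)
    (hb : IsBasicKnotVector p n ξ) :
    ∑ i : Fin n, jumpCoeff p ℓ ξ i₀ (i + 1) ^ 2 /
        ((ξ (i + 1 + p + 1) - ξ (i + 1)) / (p + 1)) =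
      jumpCoeff p ℓ ξ i₀ (i₀ - ℓ) ^ 2 * (1 / localWeight p ξ i₀ (p + 2 - ℓ) ^ 2 +
        ∑ j ∈ Finset.Icc 1 (p + 1 - ℓ), 1 / localWeight p ξ i₀ j ^ 2 *
          ∏ i ∈ Finset.Icc j (p + 1 - ℓ), muCoeff p ξ i₀ i ^ 2) := by
  have h3 := h.le_index
  have h4 := h.index_le
  have h5 := h.le_degree
  -- With `a = i₀-p-2`, the local index `j` is the global index `a + j`; outside `1 ≤ j ≤ p+2-ℓ` the
  -- jump coefficients vanish.
  obtain ⟨a, rfl⟩ := Nat.exists_eq_add_of_le (show p + 2 ≤ i₀ by omega)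
  let f : ℕ → ℝ := fun i => jumpCoeff p ℓ ξ (p + 2 + a) i ^ 2 / ((ξ (i + p + 1) - ξ i) / (p + 1))
  have hf : ∀ j, 1 ≤ j → j ≤ p + 2 - ℓ → f (a + j) =
      jumpCoeff p ℓ ξ (p + 2 + a) (p + 2 + a - ℓ) ^ 2 * (1 / localWeight p ξ (p + 2 + a) j ^ 2 *
        ∏ i ∈ Finset.Icc j (p + 1 - ℓ), muCoeff p ξ (p + 2 + a) i ^ 2) := by
    intro j h1 h2
    have e1 := h.jumpCoeff_sq_eq_prod hξ hb (p + 2 - ℓ - j) (by omega)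
    rw [show p + 2 - ℓ - (p + 2 - ℓ - j) = j by omega,
      show p + 2 + a + j - (p + 2) = a + j by omega] at e1
    rw [h.localWeight_sq hb h1 h2, show p + 2 + a + j - (p + 2) = a + j by omega]
    simp only [f]
    rw [e1]
    ring
  have hsub : Finset.Icc (a + 1) (a + (p + 2 - ℓ)) ⊆ Finset.Icc 1 n := by
    intro i hi
    rw [Finset.mem_Icc] at hi ⊢
    omega
  have hsum : ∑ i : Fin n, f (i + 1) = ∑ i ∈ Finset.Icc 1 n, f i := by
    rw [← Finset.sum_range fun i => f (i + 1), Finset.range_eq_Ico, Finset.sum_Ico_add' f 0 n 1]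
    rfl
  rw [show ∑ i : Fin n, jumpCoeff p ℓ ξ (p + 2 + a) (i + 1) ^ 2 /
        ((ξ (i + 1 + p + 1) - ξ (i + 1)) / (p + 1)) = ∑ i : Fin n, f (i + 1) from rfl, hsum,
    ← Finset.sum_subset hsub, ← Finset.map_add_left_Icc, Finset.sum_map]
  · simp only [addLeftEmbedding_apply]
    rw [Finset.sum_congr rfl fun j hj => hf j (Finset.mem_Icc.1 hj).1 (Finset.mem_Icc.1 hj).2,
      ← Finset.mul_sum, show p + 2 - ℓ = p + 1 - ℓ + 1 by omega,
      ← Finset.insert_Icc_right_eq_Icc_add_one (by omega), Finset.sum_insert (by simp),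
      Finset.Icc_eq_empty (show ¬ p + 1 - ℓ + 1 ≤ p + 1 - ℓ by omega)]
    simp
  · intro i hi hi'
    rw [Finset.mem_Icc] at hi hi'
    have : jumpCoeff p ℓ ξ (p + 2 + a) i = 0 := by
      rcases Nat.lt_or_ge (i + p + 1) (p + 2 + a) with h6 | h6
      · exact h.jumpCoeff_of_lt hξ h6
      · rw [h.jumpCoeff_of_le hξ (by omega), if_neg (by omega)]
    simp [f, this]

theorem sum_local_nonneg (p ℓ : ℕ) (ξ : ℕ → ℝ) (i₀ : ℕ) :
    0 ≤ ∑ j ∈ Finset.Icc 1 (p + 1 - ℓ), 1 / localWeight p ξ i₀ j ^ 2 *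
      ∏ i ∈ Finset.Icc j (p + 1 - ℓ), muCoeff p ξ i₀ i ^ 2 :=
  Finset.sum_nonneg fun _ _ => mul_nonneg (by positivity)
    (Finset.prod_nonneg fun _ _ => sq_nonneg _)

theorem Cloc_pos (h : IsLastInteriorKnot p n ℓ ξ i₀) (hξ : Monotone ξ)
    (hb : IsBasicKnotVector p n ξ) : 0 < Cloc p ℓ ξ i₀ := by
  have h5 := h.le_degree
  have h1 := h.prod_knot_sub_pos hξ
  have h2 := h.localWeight_pos hb (j := p + 2 - ℓ) (by omega) le_rfl
  have h3 := sum_local_nonneg p ℓ ξ i₀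
  rw [Cloc, rLast, gammaLoc]
  positivity

/-- The factorials and the knot product in `C_loc` cancel `κ_{i₀-ℓ}`, and `r_{p+2-ℓ}²` cancels the
remaining bracket: `C_loc` is the reciprocal of the dual norm of the jump functional. -/
theorem Cloc_sq_mul_sum (h : IsLastInteriorKnot p n ℓ ξ i₀) (hξ : Monotone ξ)
    (hb : IsBasicKnotVector p n ξ) :
    Cloc p ℓ ξ i₀ ^ 2 * ∑ i : Fin n, jumpCoeff p ℓ ξ i₀ (i + 1) ^ 2 /
        ((ξ (i + 1 + p + 1) - ξ (i + 1)) / (p + 1)) = 1 := by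
  have h5 := h.le_degree
  have h1 := h.prod_knot_sub_pos hξ
  have h2 := h.localWeight_pos hb (j := p + 2 - ℓ) (by omega) le_rfl
  have h3 := sum_local_nonneg p ℓ ξ i₀
  rw [h.sum_jumpCoeff_sq_div hξ hb, h.jumpCoeff_of_le hξ le_rfl, if_pos rfl, Cloc, rLast, gammaLoc]
  generalize localWeight p ξ i₀ (p + 2 - ℓ) = e at *
  generalize ∑ j ∈ Finset.Icc 1 (p + 1 - ℓ), 1 / localWeight p ξ i₀ j ^ 2 *
      ∏ i ∈ Finset.Icc j (p + 1 - ℓ), muCoeff p ξ i₀ i ^ 2 = S at *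
  generalize ∏ k ∈ Finset.Icc (i₀ + 1) (i₀ + (p - ℓ)), (ξ k - ξ i₀) = Q at *
  have hp : (0 : ℝ) < p.factorial := by positivity
  have hl : (0 : ℝ) < ℓ.factorial := by positivity
  have hS : 0 < 1 + e ^ 2 * S := by positivity
  rw [mul_pow, mul_pow, mul_pow, inv_pow, Real.sq_sqrt hS.le]
  field_simp

/-! ### The coarse space as a hyperplane, and the distance to it -/

theorem splineSpace_removeKnot_le (h : IsLastInteriorKnot p n ℓ ξ i₀) (hξ : Monotone ξ) :
    splineSpace p (n - 1) (removeKnot ξ i₀) ≤ splineSpace p n ξ := by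
  have h3 := h.le_index
  have h4 := h.index_le
  have hB : ∀ i, 1 ≤ i → i ≤ n → bspline p n ξ i ∈ splineSpace p n ξ := fun i h1 h2 =>
    Submodule.subset_span ⟨i, ⟨h1, h2⟩, rfl⟩
  refine Submodule.span_le.2 ?_
  rintro _ ⟨i, ⟨h1, h2⟩, rfl⟩
  rcases Nat.lt_or_ge i i₀ with h6 | h6
  · rcases Nat.lt_or_ge (i + p + 1) i₀ with h7 | h7
    · rw [bspline_removeKnot_of_lt (by omega) h4 h7]
      exact hB i h1 (by omega)
    · rw [bspline_removeKnot_eq hξ (by omega) h4 h6 h7]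
      exact Submodule.add_mem _ (Submodule.smul_mem _ _ (hB i h1 (by omega)))
        (Submodule.smul_mem _ _ (hB (i + 1) (by omega) (by omega)))
  · rw [bspline_removeKnot_of_le (by omega) h4 h6]
    exact hB (i + 1) (by omega) (by omega)

/-- The coarse space has codimension at most one: modulo it, knot insertion reduces each `B_i` with
`i < i₀-ℓ` to a multiple of `B_{i+1}` or to zero, and each `B_i` with `i > i₀-ℓ` to zero. -/
theorem splineSpace_le (h : IsLastInteriorKnot p n ℓ ξ i₀) (hξ : Monotone ξ) :
    splineSpace p n ξ ≤ splineSpace p (n - 1) (removeKnot ξ i₀) ⊔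
      Submodule.span ℝ {bspline p n ξ (i₀ - ℓ)} := by
  have h3 := h.le_index
  have h4 := h.index_le
  have h5 := h.le_degree
  set T := splineSpace p (n - 1) (removeKnot ξ i₀) ⊔ Submodule.span ℝ {bspline p n ξ (i₀ - ℓ)}
  have hB : ∀ i, 1 ≤ i → i ≤ n - 1 → bspline p (n - 1) (removeKnot ξ i₀) i ∈ T :=
    fun i h1 h2 => Submodule.mem_sup_left (Submodule.subset_span ⟨i, ⟨h1, h2⟩, rfl⟩)
  have hmid : bspline p n ξ (i₀ - ℓ) ∈ T :=
    Submodule.mem_sup_right (Submodule.mem_span_singleton_self _)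
  have hlow : ∀ d, d < i₀ - ℓ → bspline p n ξ (i₀ - ℓ - d) ∈ T := by
    intro d
    induction d with
    | zero => intro _; exact hmid
    | succ d ih =>
      intro hd
      obtain ⟨i, hi⟩ : ∃ i, i = i₀ - ℓ - (d + 1) := ⟨_, rfl⟩
      have ih' := ih (by omega)
      rw [show i₀ - ℓ - d = i + 1 by omega] at ih'
      have hi' := hB i (by omega) (by omega)
      rw [← hi]
      rcases Nat.lt_or_ge (i + p + 1) i₀ with h7 | h7
      · rwa [bspline_removeKnot_of_lt (by omega) h4 h7] at hi'
      · rw [bspline_removeKnot_eq hξ (by omega) h4 (by omega) h7] at hi'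
        have l1 : ξ i < ξ i₀ := (hξ (by omega)).trans_lt h.lt_knot
        have l2 : ξ i₀ ≤ ξ (i + p + 1) := hξ h7
        have n1 : (ξ i₀ - ξ i) / (ξ (i + p + 1) - ξ i) ≠ 0 :=
          div_ne_zero (by linarith) (by linarith)
        exact (Submodule.smul_mem_iff _ n1).1
          ((Submodule.add_mem_iff_left _ (Submodule.smul_mem _ _ ih')).1 hi')
  refine Submodule.span_le.2 ?_
  rintro _ ⟨i, ⟨h1, h2⟩, rfl⟩
  rcases Nat.lt_or_ge (i₀ - ℓ) i with h6 | h6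
  · have hi' := hB (i - 1) (by omega) (by omega)
    rcases Nat.lt_or_ge (i - 1) i₀ with h7 | h7
    -- Here `ξ (i - 1) = ζ`, so the first insertion coefficient is zero and the coarse B-spline is a
    -- nonzero multiple of `B_i`.
    · rw [bspline_removeKnot_eq hξ (by omega) h4 h7 (by omega), h.knot_eq (i - 1) (by omega)
        (by omega), show i - 1 + 1 = i by omega, h.knot_eq i (by omega) (by omega), sub_self,
        zero_div, zero_smul, zero_add] at hi'
      have l1 : ξ i₀ < ξ (i - 1 + p + 2) := h.knot_lt.trans_le (hξ (by omega))
      exact (Submodule.smul_mem_iff _ (div_ne_zero (by linarith) (by linarith))).1 hi'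
    · rwa [bspline_removeKnot_of_le (by omega) h4 h7, show i - 1 + 1 = i by omega] at hi'
  · have := hlow (i₀ - ℓ - i) (by omega)
    rwa [show i₀ - ℓ - (i₀ - ℓ - i) = i by omega] at this

/-- The splines of the coarser space are those whose derivative of order `p - ℓ` has no jump. -/
theorem mem_splineSpace_removeKnot_iff (h : IsLastInteriorKnot p n ℓ ξ i₀) (hξ : Monotone ξ)
    {s : ℝ → ℝ} (hs : s ∈ splineSpace p n ξ) :
    s ∈ splineSpace p (n - 1) (removeKnot ξ i₀) ↔ HasPolynomialJump (p - ℓ) s (ξ i₀) 0 := by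
  have hzero : ∀ g ∈ splineSpace p (n - 1) (removeKnot ξ i₀),
      HasPolynomialJump (p - ℓ) g (ξ i₀) 0 := by
    intro g hg
    obtain ⟨c, rfl⟩ := mem_splineSpace_iff.1 hg
    simpa using HasPolynomialJump.sum Finset.univ fun i : Fin (n - 1) =>
      (h.hasPolynomialJump_bspline_removeKnot hξ (i + 1)).const_smul (c i)
  refine ⟨hzero s, fun hJ => ?_⟩
  obtain ⟨g, hg, f, hf, rfl⟩ := Submodule.mem_sup.1 (h.splineSpace_le hξ hs)
  obtain ⟨t, rfl⟩ := Submodule.mem_span_singleton.1 hf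
  have := ((hzero g hg).add ((h.hasPolynomialJump_bspline hξ (i₀ - ℓ)).const_smul t)).unique hJ
  rw [zero_add] at this
  rw [(mul_eq_zero.1 this).resolve_right (h.jumpCoeff_last_pos hξ).ne', zero_smul, add_zero]
  exact hg

theorem isKnotRemovalError (h : IsLastInteriorKnot p n ℓ ξ i₀) (hξ : Monotone ξ)
    (hb : IsBasicKnotVector p n ξ) {s : ℝ → ℝ} (hs : s ∈ splineSpace p n ξ) :
    ∃ J, HasJump (iteratedDeriv (p - ℓ) s) (ξ i₀) J ∧
      IsKnotRemovalError p n ξ i₀ s (Cloc p ℓ ξ i₀ * |J|) := by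
  obtain ⟨c, hc⟩ := mem_splineSpace_iff.1 hs
  let κ : Fin n → ℝ := fun i => jumpCoeff p ℓ ξ i₀ (i + 1)
  let w : Fin n → ℝ := fun i => (ξ (i + 1 + p + 1) - ξ (i + 1)) / (p + 1)
  have hw : ∀ i, 0 < w i := fun i =>
    div_pos (sub_pos.2 (hb.lt_add (i + 1) (by omega) i.2)) (by positivity)
  have hjump : ∀ (f : ℝ → ℝ) (d : Fin n → ℝ), IsControlPoints p n ξ f d →
      HasPolynomialJump (p - ℓ) f (ξ i₀) (∑ i, d i * κ i) := by
    rintro _ d rfl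
    exact HasPolynomialJump.sum Finset.univ fun i : Fin n =>
      (h.hasPolynomialJump_bspline hξ (i + 1)).const_smul (d i)
  have hnorm : ∀ (f : ℝ → ℝ) (d : Fin n → ℝ), IsControlPoints p n ξ f d →
      xiNorm p n ξ f = √(∑ i, d i ^ 2 * w i) := by
    intro f d hd
    rw [xiNorm, hd.controlPoints_eq hξ hb]
  have hsub : ∀ (f g : ℝ → ℝ) (d e : Fin n → ℝ), IsControlPoints p n ξ f d →
      IsControlPoints p n ξ g e → IsControlPoints p n ξ (f - g) (d - e) := by
    rintro _ _ d e rfl rfl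
    simp only [IsControlPoints, Pi.sub_apply, sub_smul, Finset.sum_sub_distrib]
  have hC := h.Cloc_pos hξ hb
  have hCK : Cloc p ℓ ξ i₀ ^ 2 * ∑ i, κ i ^ 2 / w i = 1 := h.Cloc_sq_mul_sum hξ hb
  set C := Cloc p ℓ ξ i₀
  obtain ⟨J, hJ⟩ : ∃ J, J = ∑ i, c i * κ i := ⟨_, rfl⟩
  have hCJ : C * |J| = √((C * J) ^ 2) := by
    rw [Real.sqrt_sq_eq_abs, abs_mul, abs_of_pos hC]
  refine ⟨J, hJ ▸ (hjump s c hc).hasJump, ?_, ?_⟩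
  -- The correction is orthogonal to the hyperplane in the weighted inner product; the factor `C² J`
  -- gives it jump exactly `J`.
  · let d : Fin n → ℝ := fun i => C ^ 2 * J * (κ i / w i)
    let g : ℝ → ℝ := ∑ i : Fin n, (c - d) i • bspline p n ξ (i + 1)
    have hg : IsControlPoints p n ξ g (c - d) := rfl
    have hgS : g ∈ splineSpace p n ξ := mem_splineSpace_iff.2 ⟨_, hg⟩
    refine ⟨g, (h.mem_splineSpace_removeKnot_iff hξ hgS).2 ?_, ?_⟩
    · convert hjump g _ hg using 1
      have : ∑ i : Fin n, d i * κ i = J * (C ^ 2 * ∑ i, κ i ^ 2 / w i) := by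
        rw [Finset.mul_sum, Finset.mul_sum]
        exact Finset.sum_congr rfl fun i _ => by simp only [d]; ring
      simp only [Pi.sub_apply, sub_mul, Finset.sum_sub_distrib]
      rw [this, hCK, mul_one, ← hJ, sub_self]
    · rw [hnorm _ _ (hsub _ _ _ _ hg hc), hCJ]
      congr 1
      have : ∑ i : Fin n, (c - d - c) i ^ 2 * w i =
          (C * J) ^ 2 * (C ^ 2 * ∑ i, κ i ^ 2 / w i) := by
        rw [Finset.mul_sum, Finset.mul_sum]
        refine Finset.sum_congr rfl fun i _ => ?_
        have := (hw i).ne'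
        simp only [Pi.sub_apply, d]
        field_simp
        ring
      rw [this, hCK, mul_one]
  · rintro _ ⟨g, hg, rfl⟩
    have hgS := h.splineSpace_removeKnot_le hξ hg
    obtain ⟨a, ha⟩ := mem_splineSpace_iff.1 hgS
    have ha0 : ∑ i, a i * κ i = 0 :=
      (hjump g a ha).unique ((h.mem_splineSpace_removeKnot_iff hξ hgS).1 hg)
    rw [hnorm _ _ (hsub _ _ _ _ ha hc), hCJ]
    refine Real.sqrt_le_sqrt ?_
    -- Weighted Cauchy–Schwarz, splitting each term as `(κ_i / √w_i) · ((a - c)_i √w_i)`.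
    have hcs := Finset.sum_sq_le_sum_mul_sum_of_sq_le_mul Finset.univ
      (r := fun i => (a - c) i * κ i) (f := fun i => κ i ^ 2 / w i)
      (g := fun i => (a - c) i ^ 2 * w i)
      (fun i _ => div_nonneg (sq_nonneg _) (hw i).le)
      (fun i _ => mul_nonneg (sq_nonneg _) (hw i).le)
      (fun i _ => by
        have := (hw i).ne'
        refine le_of_eq ?_
        field_simp)
    have hsum : ∑ i, (a - c) i * κ i = -J := by
      simp only [Pi.sub_apply, sub_mul, Finset.sum_sub_distrib]
      rw [ha0, zero_sub, hJ]
    rw [hsum, neg_sq] at hcs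
    calc (C * J) ^ 2 = C ^ 2 * J ^ 2 := mul_pow _ _ _
      _ ≤ C ^ 2 * ((∑ i, κ i ^ 2 / w i) * ∑ i, (a - c) i ^ 2 * w i) :=
        mul_le_mul_of_nonneg_left hcs (sq_nonneg _)
      _ = ∑ i, (a - c) i ^ 2 * w i := by rw [← mul_assoc, hCK, one_mul]

end IsLastInteriorKnot

/-! ### Multiplicity, locality of the constant, and conclusion -/

theorem isLastInteriorKnot_of_knotMultiplicity {p n ℓ : ℕ} {ξ : ℕ → ℝ} (hξ : Monotone ξ)
    (hb : IsBasicKnotVector p n ξ) {i₀ : ℕ}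
    (hζ : ξ i₀ ∈ Set.Ioo (ξ (p + 1)) (ξ (n + 1))) (hlast : ξ i₀ < ξ (i₀ + 1))
    (hℓ : knotMultiplicity p n ξ (ξ i₀) = ℓ + 1) : IsLastInteriorKnot p n ℓ ξ i₀ := by
  have hn : i₀ ≤ n := by
    by_contra hlt
    exact absurd (hξ (show n + 1 ≤ i₀ by omega)) (not_le.2 hζ.2)
  have hex : ∃ i, ξ i₀ ≤ ξ i := ⟨i₀, le_rfl⟩
  -- `lo` is the first occurrence of `ζ`, so `i₀ - lo = ℓ`.
  obtain ⟨lo, hlo, hmin⟩ : ∃ lo, ξ i₀ ≤ ξ lo ∧ ∀ j < lo, ξ j < ξ i₀ :=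
    ⟨Nat.find hex, Nat.find_spec hex, fun j hj => not_le.1 (Nat.find_min hex hj)⟩
  have hle : lo ≤ i₀ := not_lt.1 fun hlt => lt_irrefl _ (hmin i₀ hlt)
  have hp : p + 1 < lo := by
    by_contra hlt
    exact absurd (hlo.trans (hξ (show lo ≤ p + 1 by omega))) (not_le.2 hζ.1)
  have heq : ∀ j, lo ≤ j → j ≤ i₀ → ξ j = ξ i₀ := fun j h1 h2 =>
    le_antisymm (hξ h2) (hlo.trans (hξ h1))
  have hset : {i : ℕ | 1 ≤ i ∧ i ≤ n + p + 1 ∧ ξ i = ξ i₀} = Finset.Icc lo i₀ := by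
    ext i
    simp only [Set.mem_ofPred_eq, Finset.coe_Icc, Set.mem_Icc]
    constructor
    · rintro ⟨_, _, h⟩
      constructor
      · by_contra hlt
        exact absurd (hmin i (by omega)) (by rw [h]; exact lt_irrefl _)
      · by_contra hlt
        have := hlast.trans_le (hξ (show i₀ + 1 ≤ i by omega))
        rw [h] at this
        exact lt_irrefl _ this
    · rintro ⟨h1, h2⟩
      exact ⟨by omega, by omega, heq i h1 h2⟩
  rw [knotMultiplicity, hset, Set.ncard_coe_finset, Nat.card_Icc] at hℓ
  have hℓp : ℓ ≤ p := by
    by_contra hlt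
    have := hb.lt_add lo (by omega) (by omega)
    rw [heq lo le_rfl hle, heq (lo + p + 1) (by omega) (by omega)] at this
    exact lt_irrefl _ this
  exact ⟨by omega, hn, hℓp, hmin _ (by omega), fun j h1 h2 => heq j (by omega) h2, hlast⟩

theorem Cloc_congr {p ℓ : ℕ} {ξ ξ' : ℕ → ℝ} {i₀ i₀' : ℕ} (hℓ : ℓ ≤ p) (hi₀ : p + 2 ≤ i₀)
    (hi₀' : p + 2 ≤ i₀')
    (h : ∀ j ≤ 2 * p + 2 - ℓ, ξ' (i₀' - (p + 1) + j) = ξ (i₀ - (p + 1) + j)) :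
    Cloc p ℓ ξ' i₀' = Cloc p ℓ ξ i₀ := by
  -- Both configurations are compared by the offset from `i₀`, so the constant is independent of
  -- where the local knots sit in the vector.
  have hk : ∀ k k', i₀ ≤ k + (p + 1) → k ≤ i₀ + (p + 1) - ℓ → k' + i₀ = k + i₀' →
      ξ' k' = ξ k := by
    intro k k' h1 h2 h3
    have := h (k + (p + 1) - i₀) (by omega)
    rwa [show i₀' - (p + 1) + (k + (p + 1) - i₀) = k' by omega,
      show i₀ - (p + 1) + (k + (p + 1) - i₀) = k by omega] at this
  have hw : ∀ j, 1 ≤ j → j ≤ p + 2 - ℓ → localWeight p ξ' i₀' j = localWeight p ξ i₀ j := by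
    intro j h1 h2
    rw [localWeight, localWeight, knotWeight, knotWeight,
      hk (i₀ + j - (p + 2) + p + 1) _ (by omega) (by omega) (by omega),
      hk (i₀ + j - (p + 2)) _ (by omega) (by omega) (by omega)]
  have hα : ∀ j, 1 ≤ j → j ≤ p + 2 - ℓ →
      insertionCoeff p ξ' i₀' j = insertionCoeff p ξ i₀ j := by
    intro j h1 h2
    rw [insertionCoeff, insertionCoeff, hk i₀ i₀' (by omega) (by omega) (by omega),
      hk (i₀ + j - 1) (i₀' + j - 1) (by omega) (by omega) (by omega),
      hk (i₀ + j - (p + 2)) (i₀' + j - (p + 2)) (by omega) (by omega) (by omega)]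
  have hμ : ∀ j, 1 ≤ j → j ≤ p + 1 - ℓ → muCoeff p ξ' i₀' j = muCoeff p ξ i₀ j := by
    intro j h1 h2
    rw [muCoeff, muCoeff, hα j h1 (by omega), hα (j + 1) (by omega) (by omega)]
  have hS : ∑ j ∈ Finset.Icc 1 (p + 1 - ℓ), 1 / localWeight p ξ' i₀' j ^ 2 *
        ∏ i ∈ Finset.Icc j (p + 1 - ℓ), muCoeff p ξ' i₀' i ^ 2 =
      ∑ j ∈ Finset.Icc 1 (p + 1 - ℓ), 1 / localWeight p ξ i₀ j ^ 2 *
        ∏ i ∈ Finset.Icc j (p + 1 - ℓ), muCoeff p ξ i₀ i ^ 2 := by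
    refine Finset.sum_congr rfl fun j hj => ?_
    rw [Finset.mem_Icc] at hj
    rw [hw j hj.1 (by omega)]
    congr 1
    refine Finset.prod_congr rfl fun i hi => ?_
    rw [Finset.mem_Icc] at hi
    rw [hμ i (by omega) hi.2]
  have hQ : ∏ k ∈ Finset.Icc (i₀' + 1) (i₀' + (p - ℓ)), (ξ' k - ξ' i₀') =
      ∏ k ∈ Finset.Icc (i₀ + 1) (i₀ + (p - ℓ)), (ξ k - ξ i₀) := by
    rw [← Finset.map_add_left_Icc, ← Finset.map_add_left_Icc, Finset.prod_map, Finset.prod_map]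
    refine Finset.prod_congr rfl fun k hk' => ?_
    rw [Finset.mem_Icc] at hk'
    rw [addLeftEmbedding_apply, addLeftEmbedding_apply, hk (i₀ + k) _ (by omega) (by omega)
      (by omega), hk i₀ i₀' (by omega) (by omega) (by omega)]
  rw [Cloc, Cloc, rLast, rLast, gammaLoc, gammaLoc, hS, hQ, hw _ (by omega) le_rfl]

theorem theorem5 (p n : ℕ) (ξ : ℕ → ℝ) (hξ : IsBasicKnotVector p n ξ)
    (ζ : ℝ) (hζ : ζ ∈ Set.Ioo (ξ (p + 1)) (ξ (n + 1)))
    (i₀ : ℕ) (hi₀ : i₀ ∈ Set.Icc 1 (n + p + 1)) (hiζ : ξ i₀ = ζ) (hlast : ξ i₀ < ξ (i₀ + 1))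
    (ℓ : ℕ) (hℓ : knotMultiplicity p n ξ ζ = ℓ + 1) :
    0 < Cloc p ℓ ξ i₀ ∧
    (∀ (ξ' : ℕ → ℝ) (i₀' : ℕ), p + 2 ≤ i₀' →
      (∀ j ≤ 2 * p + 2 - ℓ, ξ' (i₀' - (p + 1) + j) = ξ (i₀ - (p + 1) + j)) →
      Cloc p ℓ ξ' i₀' = Cloc p ℓ ξ i₀) ∧
    ∀ s ∈ splineSpace p n ξ, ∃ J : ℝ,
      HasJump (iteratedDeriv (p - ℓ) s) ζ J ∧
      IsKnotRemovalError p n ξ i₀ s (Cloc p ℓ ξ i₀ * |J|) := by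
  -- Clamping the index makes the knots monotone on all of `ℕ` without changing those that matter.
  let η : ℕ → ℝ := fun i => ξ (max 1 (min i (n + p + 1)))
  have hη : Monotone η := fun i j hij => hξ.mono (Set.mem_Icc.2 (by omega))
    (Set.mem_Icc.2 (by omega)) (by omega)
  have hηξ : ∀ i ∈ Set.Icc 1 (n + p + 1), ξ i = η i := by
    rintro i ⟨h1, h2⟩
    simp only [η]
    congr 1
    omega
  have hdim := hξ.le_dim
  have hin : i₀ ≤ n := by
    by_contra hlt
    have := hξ.mono (show n + 1 ∈ Set.Icc 1 (n + p + 1) from ⟨by omega, by omega⟩) hi₀ (by omega)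
    linarith [hζ.2]
  have hbη : IsBasicKnotVector p n η := by
    refine ⟨hdim, hη.monotoneOn _, ?_, ?_, fun i h1 h2 => ?_⟩
    · rw [← hηξ _ ⟨by omega, by omega⟩, ← hηξ _ ⟨by omega, by omega⟩]
      exact hξ.left_lt
    · rw [← hηξ _ ⟨by omega, by omega⟩, ← hηξ _ ⟨by omega, by omega⟩]
      exact hξ.lt_right
    · rw [← hηξ _ ⟨by omega, by omega⟩, ← hηξ _ ⟨by omega, by omega⟩]
      exact hξ.lt_add i h1 h2
  have hmul : knotMultiplicity p n η ζ = ℓ + 1 := by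
    rw [← hℓ, knotMultiplicity, knotMultiplicity]
    congr 1
    ext i
    refine and_congr_right fun h1 => and_congr_right fun h2 => ?_
    rw [hηξ i ⟨h1, h2⟩]
  have hi : η i₀ = ζ := by rw [← hηξ i₀ hi₀, hiζ]
  have h : IsLastInteriorKnot p n ℓ η i₀ := by
    refine isLastInteriorKnot_of_knotMultiplicity hη hbη ?_ ?_ (by rw [hi, hmul])
    · rw [hi, ← hηξ _ ⟨by omega, by omega⟩, ← hηξ _ ⟨by omega, by omega⟩]
      exact hζ
    · rw [← hηξ _ hi₀, ← hηξ _ ⟨by omega, by omega⟩]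
      exact hlast
  have h1 := h.le_index
  have h2 := h.le_degree
  have hCloc : Cloc p ℓ η i₀ = Cloc p ℓ ξ i₀ :=
    Cloc_congr h2 (by omega) (by omega) fun j hj => (hηξ _ ⟨by omega, by omega⟩).symm
  refine ⟨hCloc ▸ h.Cloc_pos hη hbη, fun ξ' i₀' h3 h4 => Cloc_congr h2 (by omega) h3 h4, ?_⟩
  intro s hs
  rw [splineSpace_congr hηξ] at hs
  have hremove : ∀ i ∈ Set.Icc 1 (n - 1 + p + 1), removeKnot ξ i₀ i = removeKnot η i₀ i := by
    rintro i ⟨h3, h4⟩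
    unfold removeKnot
    split_ifs
    · exact hηξ _ ⟨by omega, by omega⟩
    · exact hηξ _ ⟨by omega, by omega⟩
  obtain ⟨J, hJ, hE⟩ := h.isKnotRemovalError hη hbη hs
  rw [hi] at hJ
  refine ⟨J, hJ, ?_⟩
  rwa [IsKnotRemovalError, xiNorm_congr hηξ, splineSpace_congr hremove, ← hCloc]
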